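/- Let $\rho^{AB}$ be a two-qubit state of rank two. Logarithms are to base $2$, $S$ is the von Neumann entropy and $H(x)=-x\log_2x-(1-x)\log_2(1-x)$. A POVM $\mathcal M=\{M_k\}$ (with finitely many outcomes) on qubit $A$ produces outcome $k$ with probability $p_k=\mathrm{Tr}[\rho^{AB}(M_k\otimes 1)]$ and leaves $B$ in the state $\rho^B_k=\mathrm{Tr}_A[\rho^{AB}(M_k\otimes1)]/p_k$. Put $\overline S_{\min}=\inf_{\mathcal M}\sum_kp_kS(\rho^B_k)$, $C=\sup_{\mathcal M}\big[S(\rho^B)-\sum_kp_kS(\rho^B_k)\big]$ (classical correlation) and $D=S(\rho^A)+S(\rho^B)-S(\rho^{AB})-C$ (quantum discord). Entanglement of formation $E$ and concurrence $\mathrm{Con}$ of a state of $BC$ are the convex roofs, over finite pure-state decompositions, of $S(\mathrm{Tr}_C|\varphi\rangle\langle\varphi|)$ and of $2\sqrt{S_2(\mathrm{Tr}_C|\varphi\rangle\langle\varphi|)}$, where $S_2(X)=\frac12[(\mathrm{Tr}X)^2-\mathrm{Tr}X^2]$. Then: 1. The infimum $\overline S_{\min}$ over all POVMs on $A$, and hence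 $C$ and $D$, is attained by a von Neumann (two-outcome, rank-one projective) measurement on $A$ whose two outcomes both have positive probability and whose post-measurement states satisfy $S(\rho^B_0)=S(\rho^B_1)$. 2. Every optimal POVM on $A$ induces an equi-entropy decomposition of $\rho^B$: all $\rho^B_k$ with $p_k>0$ have the same entropy. 3. There is a vector $|\Psi\rangle$ of three qubits $ABC$ with $\mathrm{Tr}_C|\Psi\rangle\langle\Psi|=\rho^{AB}$, and for every such $|\Psi\rangle$, with $\rho^{BC}=\mathrm{Tr}_A|\Psi\rangle\langle\Psi|$, $$\overline S_{\min}=E(\rho^{BC}),\quad C=S(\rho^B)-E(\rho^{BC}),\quad D=S(\rho^A)+E(\rho^{BC})-S(\rho^{AB}),\quad E(\rho^{BC})=H\Big(\tfrac{1+\sqrt{1-\mathrm{Con}(\rho^{BC})^2}}2\Big).$$ 4. Up to local unitary operations, $\rho^{AB}=\lambda_0|\psi_0\rangle\langle\psi_0|+\lambda_1|\psi_1\rangle\langle\psi_1|$ with $$|\psi_0\rangle=a_0|0\rangle|0\rangle+b_0|\eta\rangle|1\rangle,\quad |\psi_1\rangle=a_1|1\rangle|0\rangle+b_1|\eta^\perp\rangle|1\rangle,\quad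 |\eta\rangle=c|0\rangle+d|1\rangle,\quad |\eta^\perp\rangle=-d^*|0\rangle+c^*|1\rangle,$$ where $\lambda_k>0$, $\lambda_0+\lambda_1=1$, $a_k,b_k,c,d\in\mathbb C$, $|a_k|^2+|b_k|^2=1$ and $|c|^2+|d|^2=1$. For every choice of such parameters and every $\rho^{BC}$ as in 3, $$\mathrm{Con}(\rho^{BC})^2=2\lambda_0\lambda_1\Big[|a_0b_1c^*-a_1b_0c|^2+2|d|^2(|a_0|^2|b_1|^2+|a_1|^2|b_0|^2)\Big]-2\lambda_0\lambda_1\Big|(a_0b_1c^*-a_1b_0c)^2-4a_0a_1b_0b_1|d|^2\Big|.$$ If $a_k,b_k,c,d$ are real, then $\mathrm{Con}(\rho^{BC})^2=4\lambda_0\lambda_1d^2(a_0b_1+a_1b_0)^2$ when $c^2(a_0b_1-a_1b_0)^2\ge4a_0a_1b_0b_1d^2$, and $\mathrm{Con}(\rho^{BC})^2=4\lambda_0\lambda_1(a_0b_1-a_1b_0)^2$ otherwise. -/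

import Mathlib

open scoped Kronecker ComplexOrder

noncomputable section

namespace RankTwoDiscord

/-- A density matrix: positive semidefinite with unit trace. -/
def IsDensity {n : Type*} [Fintype n] (ρ : Matrix n n ℂ) : Prop :=
  ρ.PosSemidef ∧ ρ.trace = 1

/-- The partial trace over the first factor. -/
def traceFst {m n : Type*} [Fintype m] (X : Matrix (m × n) (m × n) ℂ) : Matrix n n ℂ :=
  Matrix.of fun j j' => ∑ i, X (i, j) (i, j')

/-- The partial trace over the second factor. -/
def traceSnd {m n : Type*} [Fintype n] (X : Matrix (m × n) (m × n) ℂ) : Matrix m m ℂ :=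
  Matrix.of fun i i' => ∑ j, X (i, j) (i', j)

/-- The von Neumann entropy `-Tr (ρ log₂ ρ)` of a Hermitian matrix: the sum of `-t log₂ t` over
its eigenvalues, counted with multiplicity (they are real, and `0 log₂ 0 = 0`). -/
def entropy {n : Type*} [Fintype n] [DecidableEq n] (ρ : Matrix n n ℂ) : ℝ :=
  (ρ.charpoly.roots.map fun z => -(z.re * Real.logb 2 z.re)).sum

/-- The binary entropy function, in bits. -/
def binH (x : ℝ) : ℝ := -x * Real.logb 2 x - (1 - x) * Real.logb 2 (1 - x)

/-! ### Measurements on the first party -/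

/-- A POVM with finitely many outcomes. -/
def IsPOVM {n k : Type*} [Fintype n] [DecidableEq n] [Fintype k] (M : k → Matrix n n ℂ) : Prop :=
  (∀ i, (M i).PosSemidef) ∧ ∑ i, M i = 1

/-- A von Neumann measurement on a qubit: two complementary orthogonal projections, each onto a
one-dimensional subspace. -/
def IsVonNeumann (P : Fin 2 → Matrix (Fin 2) (Fin 2) ℂ) : Prop :=
  (∀ i, (P i).IsHermitian ∧ P i * P i = P i ∧ (P i).rank = 1) ∧ ∑ i, P i = 1

/-- The probability `Tr [ρ (M ⊗ 1)]` of an outcome with POVM element `M`. -/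
def outcomeProb (ρ : Matrix (Fin 2 × Fin 2) (Fin 2 × Fin 2) ℂ)
    (M : Matrix (Fin 2) (Fin 2) ℂ) : ℝ :=
  (ρ * (M ⊗ₖ (1 : Matrix (Fin 2) (Fin 2) ℂ))).trace.re

/-- The state `Tr_A [ρ (M ⊗ 1)] / p` of the second qubit after an outcome with POVM element `M`
(meaningful when the probability `p` of the outcome is nonzero). -/
def postState (ρ : Matrix (Fin 2 × Fin 2) (Fin 2 × Fin 2) ℂ)
    (M : Matrix (Fin 2) (Fin 2) ℂ) : Matrix (Fin 2) (Fin 2) ℂ :=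
  (outcomeProb ρ M)⁻¹ • traceFst (ρ * (M ⊗ₖ (1 : Matrix (Fin 2) (Fin 2) ℂ)))

/-- The average entropy `∑ₖ pₖ S(ρₖ)` of the ensemble of the second qubit induced by `M`. -/
def avgEntropy (ρ : Matrix (Fin 2 × Fin 2) (Fin 2 × Fin 2) ℂ) {n : ℕ}
    (M : Fin n → Matrix (Fin 2) (Fin 2) ℂ) : ℝ :=
  ∑ k, outcomeProb ρ (M k) * entropy (postState ρ (M k))

/-- The average entropies of all POVMs on the first qubit. -/
def avgEntropies (ρ : Matrix (Fin 2 × Fin 2) (Fin 2 × Fin 2) ℂ) : Set ℝ :=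
  {x | ∃ (n : ℕ) (M : Fin n → Matrix (Fin 2) (Fin 2) ℂ), IsPOVM M ∧ x = avgEntropy ρ M}

/-- The minimal average entropy. -/
def minAvgEntropy (ρ : Matrix (Fin 2 × Fin 2) (Fin 2 × Fin 2) ℂ) : ℝ :=
  sInf (avgEntropies ρ)

/-- The amounts of information about the second qubit acquired by all POVMs on the first. -/
def infoGains (ρ : Matrix (Fin 2 × Fin 2) (Fin 2 × Fin 2) ℂ) : Set ℝ :=
  {x | ∃ (n : ℕ) (M : Fin n → Matrix (Fin 2) (Fin 2) ℂ), IsPOVM M ∧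
    x = entropy (traceFst ρ) - avgEntropy ρ M}

/-- The classical correlation (measurement on the first qubit). -/
def classicalCorr (ρ : Matrix (Fin 2 × Fin 2) (Fin 2 × Fin 2) ℂ) : ℝ :=
  sSup (infoGains ρ)

/-- The total correlation (quantum mutual information). -/
def mutualInfo (ρ : Matrix (Fin 2 × Fin 2) (Fin 2 × Fin 2) ℂ) : ℝ :=
  entropy (traceSnd ρ) + entropy (traceFst ρ) - entropy ρ

/-- The quantum discord (measurement on the first qubit). -/
def discord (ρ : Matrix (Fin 2 × Fin 2) (Fin 2 × Fin 2) ℂ) : ℝ :=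
  mutualInfo ρ - classicalCorr ρ

/-! ### Entanglement of formation and concurrence -/

/-- The rank-one operator `|ψ⟩⟨ψ|`. -/
def pureState {n : Type*} (ψ : n → ℂ) : Matrix n n ℂ := Matrix.vecMulVec ψ (star ψ)

/-- The convex roof at `ρ` of a function `f` of unit vectors: the infimum of `∑ₖ pₖ f(φₖ)` over all
finite pure-state decompositions `ρ = ∑ₖ pₖ |φₖ⟩⟨φₖ|`. -/
def convexRoof {n : Type*} [Fintype n] (f : (n → ℂ) → ℝ) (ρ : Matrix n n ℂ) : ℝ :=
  sInf {x | ∃ (N : ℕ) (p : Fin N → ℝ) (φ : Fin N → n → ℂ),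
    (∀ k, 0 ≤ p k) ∧ ∑ k, p k = 1 ∧ (∀ k, ∑ i, ‖φ k i‖ ^ 2 = 1) ∧
    ρ = ∑ k, p k • pureState (φ k) ∧ x = ∑ k, p k * f (φ k)}

/-- The entanglement of formation: the convex roof of the entropy of the reduced state. -/
def eof {m n : Type*} [Fintype m] [DecidableEq m] [Fintype n]
    (ρ : Matrix (m × n) (m × n) ℂ) : ℝ :=
  convexRoof (fun φ => entropy (traceSnd (pureState φ))) ρ

/-- The second symmetric function `S₂(A) = ((Tr A)² - Tr A²) / 2` (real for Hermitian `A`). -/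
def secondSymm {n : Type*} [Fintype n] (A : Matrix n n ℂ) : ℝ :=
  ((A.trace ^ 2 - (A * A).trace) / 2).re

/-- The concurrence: the convex roof of `2 √(S₂(ρ₁))`, with `ρ₁` the reduced state. -/
def concurrence {m n : Type*} [Fintype m] [Fintype n]
    (ρ : Matrix (m × n) (m × n) ℂ) : ℝ :=
  convexRoof (fun φ => 2 * √(secondSymm (traceSnd (pureState φ)))) ρ

/-! ### Purification -/

/-- The reduced state of `AB` of the vector `Ψ` of `ABC`. -/
def reducedAB (Ψ : Fin 2 × Fin 2 × Fin 2 → ℂ) : Matrix (Fin 2 × Fin 2) (Fin 2 × Fin 2) ℂ :=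
  traceSnd (pureState fun x : (Fin 2 × Fin 2) × Fin 2 => Ψ (x.1.1, x.1.2, x.2))

/-- The reduced state of `BC` of the vector `Ψ` of `ABC`. -/
def reducedBC (Ψ : Fin 2 × Fin 2 × Fin 2 → ℂ) : Matrix (Fin 2 × Fin 2) (Fin 2 × Fin 2) ℂ :=
  traceFst (pureState Ψ)

/-! ### Canonical form under local unitaries -/

/-- The product vector `u ⊗ v`. -/
def prodVec (u v : Fin 2 → ℂ) : Fin 2 × Fin 2 → ℂ := fun x => u x.1 * v x.2

/-- `a₀ |0⟩|0⟩ + b₀ |η⟩|1⟩` with `|η⟩ = c |0⟩ + d |1⟩`. -/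
def canonVec₀ (a b : Fin 2 → ℂ) (c d : ℂ) : Fin 2 × Fin 2 → ℂ :=
  a 0 • prodVec ![1, 0] ![1, 0] + b 0 • prodVec ![c, d] ![0, 1]

/-- `a₁ |1⟩|0⟩ + b₁ |η^⊥⟩|1⟩` with `|η^⊥⟩ = -d^* |0⟩ + c^* |1⟩`. -/
def canonVec₁ (a b : Fin 2 → ℂ) (c d : ℂ) : Fin 2 × Fin 2 → ℂ :=
  a 1 • prodVec ![0, 1] ![1, 0] + b 1 • prodVec ![-star d, star c] ![0, 1]

/-- `ρ` is carried by a local unitary to `l₀ |ψ₀⟩⟨ψ₀| + l₁ |ψ₁⟩⟨ψ₁|`, where `ψ₀`, `ψ₁` are the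
canonical orthonormal vectors with parameters `a`, `b`, `c`, `d`. -/
def HasCanonicalForm (ρ : Matrix (Fin 2 × Fin 2) (Fin 2 × Fin 2) ℂ)
    (l : Fin 2 → ℝ) (a b : Fin 2 → ℂ) (c d : ℂ) : Prop :=
  (∀ k, 0 < l k) ∧ l 0 + l 1 = 1 ∧
  (∀ k, ‖a k‖ ^ 2 + ‖b k‖ ^ 2 = 1) ∧ ‖c‖ ^ 2 + ‖d‖ ^ 2 = 1 ∧
  ∃ U ∈ Matrix.unitaryGroup (Fin 2) ℂ, ∃ V ∈ Matrix.unitaryGroup (Fin 2) ℂ,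
    (U ⊗ₖ V) * ρ * (U ⊗ₖ V).conjTranspose =
      l 0 • pureState (canonVec₀ a b c d) + l 1 • pureState (canonVec₁ a b c d)

end RankTwoDiscord

end

open RankTwoDiscord

/-!
Let `Ψ` purify the rank-two state `ρ`, and read `Ψ` as a pair `w₀, w₁` of `2 × 2` matrices from `C`
to `B`, indexed by the basis of `A`. A rank-one POVM element on `A` with coefficient vector `v`
leaves the unnormalised pure state `v₀ w₀ + v₁ w₁` on `BC`. The determinant of this matrix is a
quadratic form in `v`, with symmetric matrix `T = detForm w`; `2 |det|` divided by the squared norm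
is the concurrence of the conditional state, and the entropy of its `B` part is
`entropyOfConcurrence` of that number.

By the Takagi factorisation (`exists_takagi`) the form is `s₀ v₀² - s₁ v₁²` with `s₀ ≥ s₁ ≥ 0` in a
suitable orthonormal basis. Hence `|det|` dominates the Hermitian form `s₀ |v₀|² - s₁ |v₁|²`, and
its sum over any resolution of the identity is at least the trace `t = s₀ - s₁`
(`sub_le_sum_norm_det`). The lower bound is attained: on the real plane spanned by the Takagi basis,
`det - t ‖·‖²` is a traceless real quadratic form, so it has an orthonormal basis of isotropic
vectors, and on that basis every outcome has concurrence exactly `2 t`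
(`exists_rotation_norm_det_eq`). When `ρ^A` is pure one of these two outcomes may have probability
zero, and a balanced change of basis repairs this (`exists_rotation_pos`).

General POVM elements are sums of two rank-one ones, and the square root of the determinant is
superadditive on positive `2 × 2` matrices (`add_norm_det_le_sqrt_det`), so the average concurrence
is at least `2 t` for every POVM. Since `entropyOfConcurrence` is increasing and strictly convex
(`strictConvexOn_entropyOfConcurrence`), Jensen's inequality gives the minimal average entropy
`entropyOfConcurrence (2 t)`, and its equality case shows that the outcomes of an optimal POVM have
equal entropies. If `ρ^{BC}` has rank two, each of its pure-state decompositions comes from a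
resolution of the identity on `A` (`exists_mixing`); if it is pure, its decompositions are trivial.
In both cases the same bound computes the entanglement of formation and the concurrence of `ρ^{BC}`
(`convexRoof_reducedBC`).

Finally `t² = ‖T‖² - 2 |det T|` is unchanged by unitaries on `A`, `B` and `C`, which gives the
concurrence in the parameters of the canonical form. The canonical form exists because a traceless
`2 × 2` matrix has zero diagonal in some orthonormal basis (`exists_unit_sesq_eq_zero`): applied to
`A₀ᴴ A₁`, where `A₀`, `A₁` are the eigenvectors of `ρ` as matrices, it yields a basis of `B` along
which the components of the two eigenvectors are orthogonal in `A`.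
-/

namespace RankTwoDiscord
open Matrix

/-! ### The entropy of a pure state as a function of its concurrence -/

/-- The entropy, in bits, of a qubit state with eigenvalues `(1 ± √(1 - x²)) / 2`: the entropy of
entanglement of a two-qubit pure state as a function of its concurrence `x`. -/
noncomputable def entropyOfConcurrence (x : ℝ) : ℝ := binH ((1 + √(1 - x ^ 2)) / 2)

theorem binH_eq_binEntropy (x : ℝ) : binH x = Real.binEntropy x / Real.log 2 := by
  rw [binH, Real.binEntropy, Real.logb, Real.logb, Real.log_inv, Real.log_inv]
  ring

theorem continuous_entropyOfConcurrence : Continuous entropyOfConcurrence := by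
  have : entropyOfConcurrence =
      fun x => Real.binEntropy ((1 + √(1 - x ^ 2)) / 2) / Real.log 2 := by
    funext x; exact binH_eq_binEntropy _
  rw [this]
  fun_prop

/-- With `w = √(1 - x²) / x`, the two eigenvalues `p ≥ 1 - p` have log-ratio
`log (p / (1 - p)) = 2 arsinh w`. -/
theorem log_ratio_eq_arsinh {x : ℝ} (h0 : 0 < x) (h1 : x < 1) :
    Real.log ((1 + √(1 - x ^ 2)) / 2) - Real.log (1 - (1 + √(1 - x ^ 2)) / 2)
      = 2 * Real.arsinh (√(1 - x ^ 2) / x) := by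
  have hs2 : √(1 - x ^ 2) ^ 2 = 1 - x ^ 2 := Real.sq_sqrt (by nlinarith)
  have hs0 : 0 ≤ √(1 - x ^ 2) := Real.sqrt_nonneg _
  set s := √(1 - x ^ 2)
  have hs1 : s < 1 := by nlinarith [sq_pos_of_pos h0]
  have hsq : √(1 + (s / x) ^ 2) = 1 / x := by
    rw [Real.sqrt_eq_iff_mul_self_eq (by positivity) (by positivity)]
    field_simp
    linarith
  rw [Real.arsinh, hsq, ← Real.log_div (by positivity) (by linarith), ← Nat.cast_two,
    ← Real.log_pow]
  congr 1
  have : (1 - (1 + s) / 2) ≠ 0 := by linarith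
  have h' : 1 - s ≠ 0 := by linarith
  field_simp
  rw [div_eq_iff (by intro h; apply this; push_cast at h; linarith)]
  push_cast
  have : x ^ 2 = 1 - s ^ 2 := by linarith
  rw [this]
  ring

/-- The derivative is `arsinh w / w` with `w = √(1 - x²) / x`, so that its monotonicity follows from
the concavity of `arsinh`. -/
theorem hasDerivAt_entropyOfConcurrence {x : ℝ} (h0 : 0 < x) (h1 : x < 1) :
    HasDerivAt entropyOfConcurrence
      (Real.arsinh (√(1 - x ^ 2) / x) / (√(1 - x ^ 2) / x) / Real.log 2) x := by
  have hpos : 0 < 1 - x ^ 2 := by nlinarith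
  have hs2 : √(1 - x ^ 2) ^ 2 = 1 - x ^ 2 := Real.sq_sqrt hpos.le
  have hs0 : 0 < √(1 - x ^ 2) := Real.sqrt_pos.2 hpos
  have hs1 : √(1 - x ^ 2) < 1 := by nlinarith [sq_pos_of_pos h0]
  have hin : HasDerivAt (fun y : ℝ => (1 + √(1 - y ^ 2)) / 2)
      ((-(2 * x)) / (2 * √(1 - x ^ 2)) / 2) x := by
    have := ((((hasDerivAt_pow 2 x).const_sub 1).sqrt hpos.ne').const_add 1).div_const 2
    simpa using this
  have hH := Real.hasDerivAt_binEntropy (p := (1 + √(1 - x ^ 2)) / 2) (by linarith) (by linarith)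
  have := (hH.comp x hin).div_const (Real.log 2)
  have hf : entropyOfConcurrence =
      fun x => Real.binEntropy ((1 + √(1 - x ^ 2)) / 2) / Real.log 2 := by
    funext x; exact binH_eq_binEntropy _
  rw [hf]
  refine this.congr_deriv ?_
  have hl := log_ratio_eq_arsinh h0 h1
  rw [← neg_sub, hl]
  field_simp

theorem strictConcaveOn_arsinh : StrictConcaveOn ℝ (Set.Ici 0) Real.arsinh := by
  refine StrictAntiOn.strictConcaveOn_of_deriv (convex_Ici 0) Real.continuous_arsinh.continuousOn ?_
  rw [interior_Ici]
  intro x hx y hy hxy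
  simp only [Set.mem_Ioi] at hx hy
  rw [(Real.hasDerivAt_arsinh x).deriv, (Real.hasDerivAt_arsinh y).deriv]
  have : 0 < √(1 + x ^ 2) := Real.sqrt_pos.2 (by positivity)
  apply inv_strictAnti₀ this
  apply Real.sqrt_lt_sqrt (by positivity)
  nlinarith

theorem strictConvexOn_entropyOfConcurrence :
    StrictConvexOn ℝ (Set.Icc 0 1) entropyOfConcurrence := by
  refine StrictMonoOn.strictConvexOn_of_deriv (convex_Icc 0 1)
    continuous_entropyOfConcurrence.continuousOn ?_
  rw [interior_Icc]
  rintro x ⟨hx0, hx1⟩ y ⟨hy0, hy1⟩ hxy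
  rw [(hasDerivAt_entropyOfConcurrence hx0 hx1).deriv,
    (hasDerivAt_entropyOfConcurrence hy0 hy1).deriv]
  have hsy : 0 < √(1 - y ^ 2) := Real.sqrt_pos.2 (by nlinarith)
  have hlt : √(1 - y ^ 2) / y < √(1 - x ^ 2) / x := by
    apply div_lt_div₀ _ hxy.le (Real.sqrt_nonneg _) hx0
    exact Real.sqrt_lt_sqrt (by nlinarith) (by nlinarith)
  have hpos : 0 < √(1 - y ^ 2) / y := by positivity
  have h := strictConcaveOn_arsinh.secant_strict_mono (a := 0) (by simp) hpos.le
    (hpos.trans hlt).le hpos.ne' (hpos.trans hlt).ne' hlt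
  simp only [Real.arsinh_zero, sub_zero] at h
  exact div_lt_div_of_pos_right h (Real.log_pos (by norm_num))

theorem strictMonoOn_entropyOfConcurrence :
    StrictMonoOn entropyOfConcurrence (Set.Icc 0 1) := by
  refine strictMonoOn_of_deriv_pos (convex_Icc 0 1)
    continuous_entropyOfConcurrence.continuousOn ?_
  rw [interior_Icc]
  rintro x ⟨hx0, hx1⟩
  rw [(hasDerivAt_entropyOfConcurrence hx0 hx1).deriv]
  have hs : 0 < √(1 - x ^ 2) := Real.sqrt_pos.2 (by nlinarith)
  have hw : 0 < √(1 - x ^ 2) / x := by positivity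
  exact div_pos (div_pos (Real.arsinh_pos_iff.2 hw) hw) (Real.log_pos (by norm_num))

/-- Jensen's inequality for an average that is only bounded below. -/
theorem le_sum_of_convexOn {g : ℝ → ℝ} (hg : ConvexOn ℝ (Set.Icc 0 1) g)
    (hm : MonotoneOn g (Set.Icc 0 1)) {ι : Type*} [Fintype ι] {p x : ι → ℝ}
    (hp : ∀ k, 0 ≤ p k) (hp1 : ∑ k, p k = 1) (hx : ∀ k, x k ∈ Set.Icc (0 : ℝ) 1)
    {s : ℝ} (hs : 0 ≤ s) (hle : s ≤ ∑ k, p k * x k) : g s ≤ ∑ k, p k * g (x k) := by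
  have hmem : ∑ k, p k * x k ∈ Set.Icc (0 : ℝ) 1 :=
    (convex_Icc (0 : ℝ) 1).sum_mem (fun k _ => hp k) hp1 (fun k _ => hx k)
  refine (hm ⟨hs, hle.trans hmem.2⟩ hmem hle).trans ?_
  exact hg.map_sum_le (fun k _ => hp k) hp1 (fun k _ => hx k)

/-- Equality case of `le_sum_of_convexOn`. -/
theorem eq_of_sum_eq_of_strictConvexOn {g : ℝ → ℝ} (hg : StrictConvexOn ℝ (Set.Icc 0 1) g)
    (hm : MonotoneOn g (Set.Icc 0 1)) {ι : Type*} [Fintype ι] {p x : ι → ℝ}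
    (hp : ∀ k, 0 ≤ p k) (hp1 : ∑ k, p k = 1) (hx : ∀ k, x k ∈ Set.Icc (0 : ℝ) 1)
    {s : ℝ} (hs : 0 ≤ s) (hle : s ≤ ∑ k, p k * x k) (heq : ∑ k, p k * g (x k) ≤ g s)
    {j k : ι} (hj : 0 < p j) (hk : 0 < p k) : x j = x k := by
  have hmem : ∑ k, p k * x k ∈ Set.Icc (0 : ℝ) 1 :=
    (convex_Icc (0 : ℝ) 1).sum_mem (fun k _ => hp k) hp1 (fun k _ => hx k)
  have h1 := hm ⟨hs, hle.trans hmem.2⟩ hmem hle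
  have h2 := hg.convexOn.map_sum_le (fun k _ => hp k) hp1 (fun k _ => hx k)
  have h3 := (hg.map_sum_eq_iff' (t := Finset.univ) (fun k _ => hp k) hp1 (fun k _ => hx k)).1
    (le_antisymm h2 (heq.trans h1))
  rw [h3 j (Finset.mem_univ _) hj.ne', h3 k (Finset.mem_univ _) hk.ne']

/-! ### The Hilbert–Schmidt norm -/

/-- The square of the Hilbert–Schmidt norm of a matrix. -/
noncomputable def frobSq {m n : Type*} [Fintype m] [Fintype n] (X : Matrix m n ℂ) : ℝ :=
  ∑ i, ∑ j, ‖X i j‖ ^ 2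

theorem frobSq_nonneg {m n : Type*} [Fintype m] [Fintype n] (X : Matrix m n ℂ) : 0 ≤ frobSq X := by
  unfold frobSq; positivity

theorem frobSq_eq_zero {m n : Type*} [Fintype m] [Fintype n] {X : Matrix m n ℂ}
    (h : frobSq X = 0) : X = 0 := by
  ext i j
  have h1 := (Finset.sum_eq_zero_iff_of_nonneg (fun i _ => by positivity)).1 h i
    (Finset.mem_univ _)
  have h2 := (Finset.sum_eq_zero_iff_of_nonneg (fun j _ => by positivity)).1 h1 j
    (Finset.mem_univ _)
  simpa using h2

theorem frobSq_eq_trace {m n : Type*} [Fintype m] [Fintype n] (X : Matrix m n ℂ) :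
    (frobSq X : ℂ) = (X * Xᴴ).trace := by
  simp [frobSq, Matrix.trace, Matrix.mul_apply, Complex.mul_conj']

theorem frobSq_smul {m n : Type*} [Fintype m] [Fintype n] (z : ℂ) (X : Matrix m n ℂ) :
    frobSq (z • X) = ‖z‖ ^ 2 * frobSq X := by
  simp [frobSq, mul_pow, Finset.mul_sum]

/-! ### The determinant as a quadratic form on a pair of matrices -/

/-- The linear combination `v₀ w₀ + v₁ w₁` of a pair of matrices. -/
def mix (w : Fin 2 → Matrix (Fin 2) (Fin 2) ℂ) (v : Fin 2 → ℂ) : Matrix (Fin 2) (Fin 2) ℂ :=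
  v 0 • w 0 + v 1 • w 1

/-- The pair of linear combinations of a pair of matrices with coefficients the rows of `E`. -/
def rotate (E : Matrix (Fin 2) (Fin 2) ℂ) (w : Fin 2 → Matrix (Fin 2) (Fin 2) ℂ) :
    Fin 2 → Matrix (Fin 2) (Fin 2) ℂ :=
  fun k => mix w (E k)

/-- The symmetric matrix of the quadratic form `v ↦ det (v₀ w₀ + v₁ w₁)`. -/
noncomputable def detForm (w : Fin 2 → Matrix (Fin 2) (Fin 2) ℂ) : Matrix (Fin 2) (Fin 2) ℂ :=
  Matrix.of fun i k =>
    (w i 0 0 * w k 1 1 + w k 0 0 * w i 1 1 - w i 0 1 * w k 1 0 - w k 0 1 * w i 1 0) / 2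

theorem detForm_symm (w : Fin 2 → Matrix (Fin 2) (Fin 2) ℂ) : detForm w 1 0 = detForm w 0 1 := by
  simp [detForm]; ring

theorem det_mix (w : Fin 2 → Matrix (Fin 2) (Fin 2) ℂ) (v : Fin 2 → ℂ) :
    (mix w v).det =
      v 0 ^ 2 * detForm w 0 0 + 2 * (v 0 * v 1) * detForm w 0 1 + v 1 ^ 2 * detForm w 1 1 := by
  simp [mix, detForm, Matrix.det_fin_two]; ring

theorem detForm_rotate (E : Matrix (Fin 2) (Fin 2) ℂ) (w : Fin 2 → Matrix (Fin 2) (Fin 2) ℂ) :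
    detForm (rotate E w) = E * detForm w * Eᵀ := by
  ext i k
  simp [mix, rotate, detForm, Matrix.mul_apply, Fin.sum_univ_two]
  ring

theorem detForm_mul_mul (V Z : Matrix (Fin 2) (Fin 2) ℂ) (w : Fin 2 → Matrix (Fin 2) (Fin 2) ℂ) :
    detForm (fun i => V * w i * Z) = (V.det * Z.det) • detForm w := by
  ext i k
  simp [detForm, Matrix.mul_apply, Fin.sum_univ_two, Matrix.det_fin_two]
  ring

theorem rotate_rotate (E F : Matrix (Fin 2) (Fin 2) ℂ) (w : Fin 2 → Matrix (Fin 2) (Fin 2) ℂ) :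
    rotate E (rotate F w) = rotate (E * F) w := by
  funext k
  ext i j
  simp [mix, rotate, Matrix.mul_apply, Fin.sum_univ_two]
  ring

theorem mix_rotate (E : Matrix (Fin 2) (Fin 2) ℂ) (w : Fin 2 → Matrix (Fin 2) (Fin 2) ℂ)
    (a : Fin 2 → ℂ) : mix (rotate E w) a = mix w (a ᵥ* E) := by
  ext i j
  simp [mix, rotate, Matrix.vecMul, dotProduct, Fin.sum_univ_two]
  ring

theorem rotate_one (w : Fin 2 → Matrix (Fin 2) (Fin 2) ℂ) : rotate 1 w = w := by
  funext k
  revert k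
  simp [Fin.forall_fin_two, rotate, mix]

theorem normSq_sum_of_unitary {E : Matrix (Fin 2) (Fin 2) ℂ}
    (hE : E ∈ Matrix.unitaryGroup (Fin 2) ℂ) (x y : ℂ) :
    ‖E 0 0 * x + E 0 1 * y‖ ^ 2 + ‖E 1 0 * x + E 1 1 * y‖ ^ 2 = ‖x‖ ^ 2 + ‖y‖ ^ 2 := by
  have h := Matrix.mem_unitaryGroup_iff'.1 hE
  have h00 := congrFun₂ h 0 0
  have h01 := congrFun₂ h 0 1
  have h10 := congrFun₂ h 1 0
  have h11 := congrFun₂ h 1 1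
  simp only [Matrix.star_eq_conjTranspose, Matrix.mul_apply, Fin.sum_univ_two,
    Matrix.conjTranspose_apply, Matrix.one_apply, RCLike.star_def] at h00 h01 h10 h11
  norm_num at h00 h01 h10 h11
  have : ((‖E 0 0 * x + E 0 1 * y‖ ^ 2 + ‖E 1 0 * x + E 1 1 * y‖ ^ 2 : ℝ) : ℂ)
      = ((‖x‖ ^ 2 + ‖y‖ ^ 2 : ℝ) : ℂ) := by
    push_cast
    rw [← Complex.mul_conj', ← Complex.mul_conj', ← Complex.mul_conj', ← Complex.mul_conj']
    simp only [map_add, map_mul]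
    linear_combination (x * (starRingEnd ℂ) x) * h00 + (y * (starRingEnd ℂ) y) * h11 +
      (y * (starRingEnd ℂ) x) * h01 + (x * (starRingEnd ℂ) y) * h10
  exact_mod_cast this

theorem frobSq_rotate {E : Matrix (Fin 2) (Fin 2) ℂ}
    (hE : E ∈ Matrix.unitaryGroup (Fin 2) ℂ) (w : Fin 2 → Matrix (Fin 2) (Fin 2) ℂ) :
    ∑ k, frobSq (rotate E w k) = ∑ k, frobSq (w k) := by
  have h := fun i j => normSq_sum_of_unitary hE (w 0 i j) (w 1 i j)
  simp only [frobSq, rotate, mix, Fin.sum_univ_two, Matrix.add_apply, Matrix.smul_apply,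
    smul_eq_mul]
  linear_combination h 0 0 + h 0 1 + h 1 0 + h 1 1

/-! ### Takagi factorisation of a symmetric `2 × 2` matrix -/

/-- A traceless real symmetric form of the plane has a pair of orthonormal isotropic vectors. -/
theorem exists_isotropic (A R : ℝ) : ∃ c s : ℝ, c ^ 2 + s ^ 2 = 1 ∧
    A * (c ^ 2 - s ^ 2) = 2 * R * (c * s) := by
  by_cases hA : A = 0
  · exact ⟨1, 0, by simp [hA]⟩
  have hq : 0 ≤ R ^ 2 + A ^ 2 := by positivity
  have hsq := Real.sq_sqrt hq
  set r := (-R + √(R ^ 2 + A ^ 2)) / A with hr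
  have hroot : A * (1 - r ^ 2) = 2 * R * r := by
    rw [hr]
    field_simp
    linear_combination -hsq
  have hpos : 0 < 1 + r ^ 2 := by positivity
  have hn := Real.sq_sqrt hpos.le
  have hn0 : √(1 + r ^ 2) ≠ 0 := (Real.sqrt_pos.2 hpos).ne'
  refine ⟨1 / √(1 + r ^ 2), r / √(1 + r ^ 2), ?_, ?_⟩
  · field_simp
    linarith
  · field_simp
    linear_combination hroot

/-- A unit factor `u` with `u² z = ‖z‖`; the square is how a phase acts on a quadratic form. -/
theorem exists_phase (z : ℂ) : ∃ u : ℂ, ‖u‖ = 1 ∧ u ^ 2 * z = ‖z‖ := by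
  refine ⟨Complex.exp ((-(z.arg / 2) : ℝ) * Complex.I), Complex.norm_exp_ofReal_mul_I _, ?_⟩
  have h : Complex.exp ((-(z.arg / 2) : ℝ) * Complex.I) ^ 2 * Complex.exp (z.arg * Complex.I)
      = 1 := by
    rw [← Complex.exp_nat_mul, ← Complex.exp_add, Complex.exp_eq_one_iff]
    exact ⟨0, by push_cast; ring⟩
  linear_combination (‖z‖ : ℂ) * h -
    Complex.exp ((-(z.arg / 2) : ℝ) * Complex.I) ^ 2 * Complex.norm_mul_exp_arg_mul_I z

/-- Every traceless `2 × 2` complex matrix, here `!![α, β; γ, -α]`, vanishes as a sesquilinear form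
on some unit vector. -/
theorem exists_unit_sesq_eq_zero (α β γ : ℂ) : ∃ x y : ℂ, ‖x‖ ^ 2 + ‖y‖ ^ 2 = 1 ∧
    α * (x * star x - y * star y) + β * (star x * y) + γ * (x * star y) = 0 := by
  by_cases hα : α = 0
  · exact ⟨1, 0, by simp [hα]⟩
  -- A phase `u` for the second coordinate makes the off-diagonal part a real multiple of `α`.
  obtain ⟨u, hu, hm⟩ : ∃ u : ℂ, ‖u‖ = 1 ∧
      (star α * β - α * star γ) * u = star ((star α * β - α * star γ) * u) := by
    obtain ⟨v, hv, hv'⟩ := exists_phase (star α * β - α * star γ)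
    refine ⟨v ^ 2, by simp [hv], ?_⟩
    rw [mul_comm, hv', RCLike.star_def, Complex.conj_ofReal]
  have huu : u * star u = 1 := by
    rw [RCLike.star_def, Complex.mul_conj', hu]; simp
  have hreal : star (star α * (β * u + γ * star u)) = star α * (β * u + γ * star u) := by
    simp only [star_mul', star_add, star_sub, star_star] at hm ⊢
    linear_combination -hm
  obtain ⟨m, hm'⟩ := Complex.conj_eq_iff_real.1 hreal
  obtain ⟨c, s, h1, h2⟩ := exists_isotropic (‖α‖ ^ 2) (-m / 2)
  refine ⟨c, s * u, by simpa [hu] using h1, ?_⟩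
  have h2' : (‖α‖ : ℂ) ^ 2 * ((c : ℂ) ^ 2 - (s : ℂ) ^ 2) = 2 * (-m / 2) * (c * s) := by
    exact_mod_cast h2
  rw [← Complex.mul_conj'] at h2'
  have hα' : star α ≠ 0 := by simpa using hα
  apply mul_left_cancel₀ hα'
  simp only [RCLike.star_def, map_mul, Complex.conj_ofReal] at *
  linear_combination h2' + (c * s : ℂ) * hm' - α * (starRingEnd ℂ) α * (s : ℂ) ^ 2 * huu

/-- The unitary matrix with first row `(x, y)` and second row `(-ȳ, x̄)`. -/
theorem unitary_of_row {x y : ℂ} (h : ‖x‖ ^ 2 + ‖y‖ ^ 2 = 1) :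
    !![x, y; -star y, star x] ∈ Matrix.unitaryGroup (Fin 2) ℂ := by
  have h' : x * star x + y * star y = 1 := by
    rw [RCLike.star_def, Complex.mul_conj', Complex.mul_conj']
    exact_mod_cast h
  rw [Matrix.mem_unitaryGroup_iff]
  ext i j
  fin_cases i <;> fin_cases j <;>
    simp [Matrix.mul_apply, Fin.sum_univ_two] <;>
    simp only [RCLike.star_def] at h'
  · exact h'
  · ring
  · ring
  · linear_combination h'

theorem diagonal_mem_unitaryGroup {u v : ℂ} (hu : ‖u‖ = 1) (hv : ‖v‖ = 1) :
    !![u, 0; 0, v] ∈ Matrix.unitaryGroup (Fin 2) ℂ := by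
  have hu' : u * (starRingEnd ℂ) u = 1 := by rw [Complex.mul_conj', hu]; simp
  have hv' : v * (starRingEnd ℂ) v = 1 := by rw [Complex.mul_conj', hv]; simp
  rw [Matrix.mem_unitaryGroup_iff]
  ext i j
  fin_cases i <;> fin_cases j <;>
    simp [Matrix.mul_apply, Fin.sum_univ_two, hu', hv']

theorem swap_mem_unitaryGroup : !![0, 1; 1, 0] ∈ Matrix.unitaryGroup (Fin 2) ℂ := by
  rw [Matrix.mem_unitaryGroup_iff]
  ext i j
  fin_cases i <;> fin_cases j <;> simp [Matrix.mul_apply, Fin.sum_univ_two]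

/-- Takagi factorisation, with the smaller singular value carrying a minus sign. -/
theorem exists_takagi (T : Matrix (Fin 2) (Fin 2) ℂ) (hT : T 1 0 = T 0 1) :
    ∃ E ∈ Matrix.unitaryGroup (Fin 2) ℂ, ∃ s₀ s₁ : ℝ, 0 ≤ s₁ ∧ s₁ ≤ s₀ ∧
      E * T * Eᵀ = !![(s₀ : ℂ), 0; 0, -(s₁ : ℂ)] := by
  obtain ⟨x, y, hxy, h0⟩ := exists_unit_sesq_eq_zero (T 0 1) (T 1 1) (-(T 0 0))
  have hE := unitary_of_row hxy
  set E := !![x, y; -star y, star x] with hEdef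
  have hdiag : ∃ a b : ℂ, E * T * Eᵀ = !![a, 0; 0, b] := by
    refine ⟨(E * T * Eᵀ) 0 0, (E * T * Eᵀ) 1 1, ?_⟩
    simp only [RCLike.star_def] at h0
    ext i j
    fin_cases i <;> fin_cases j <;>
      simp [hEdef, Matrix.mul_apply, Fin.sum_univ_two, Matrix.vecMul, dotProduct, hT] <;>
      linear_combination h0
  obtain ⟨a, b, hab⟩ := hdiag
  -- Phases on the basis vectors turn the diagonal entries into `‖a‖` and `-‖b‖`.
  have main : ∀ F ∈ Matrix.unitaryGroup (Fin 2) ℂ, ∀ a b : ℂ, F * T * Fᵀ = !![a, 0; 0, b] →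
      ‖b‖ ≤ ‖a‖ → ∃ E ∈ Matrix.unitaryGroup (Fin 2) ℂ, ∃ s₀ s₁ : ℝ, 0 ≤ s₁ ∧ s₁ ≤ s₀ ∧
      E * T * Eᵀ = !![(s₀ : ℂ), 0; 0, -(s₁ : ℂ)] := by
    intro F hF a b h hle
    obtain ⟨u, hu, hua⟩ := exists_phase a
    obtain ⟨v, hv, hvb⟩ := exists_phase (-b)
    refine ⟨!![u, 0; 0, v] * F, mul_mem (diagonal_mem_unitaryGroup hu hv) hF,
      ‖a‖, ‖b‖, norm_nonneg _, hle, ?_⟩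
    have : !![u, 0; 0, v] * F * T * (!![u, 0; 0, v] * F)ᵀ
        = !![u, 0; 0, v] * (F * T * Fᵀ) * !![u, 0; 0, v]ᵀ := by
      simp only [Matrix.transpose_mul, Matrix.mul_assoc]
    rw [this, h]
    rw [norm_neg] at hvb
    ext i j
    fin_cases i <;> fin_cases j <;> simp [Matrix.mul_apply, Fin.sum_univ_two]
    · linear_combination hua
    · linear_combination -hvb
  -- If the diagonal entries come in the wrong order, the two basis vectors are swapped.
  rcases le_total ‖b‖ ‖a‖ with h | h
  · exact main E hE a b hab h
  · refine main (!![0, 1; 1, 0] * E) (mul_mem swap_mem_unitaryGroup hE) b a ?_ h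
    have : !![0, 1; 1, 0] * E * T * (!![0, 1; 1, 0] * E)ᵀ
        = !![0, 1; 1, 0] * (E * T * Eᵀ) * !![0, 1; 1, 0]ᵀ := by
      simp only [Matrix.transpose_mul, Matrix.mul_assoc]
    rw [this, hab]
    ext i j
    fin_cases i <;> fin_cases j <;> simp [Matrix.mul_apply, Fin.sum_univ_two]

/-- The square `(s₀ - s₁)²` of the gap between the singular values of a `2 × 2` matrix, written as
`s₀² + s₁² - 2 s₀ s₁`. -/
noncomputable def singularGapSq (T : Matrix (Fin 2) (Fin 2) ℂ) : ℝ := frobSq T - 2 * ‖T.det‖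

theorem norm_det_of_unitary {E : Matrix (Fin 2) (Fin 2) ℂ}
    (hE : E ∈ Matrix.unitaryGroup (Fin 2) ℂ) : ‖E.det‖ = 1 := by
  have h := congrArg Matrix.det (Matrix.mem_unitaryGroup_iff.1 hE)
  rw [Matrix.det_mul, Matrix.star_eq_conjTranspose, Matrix.det_conjTranspose, Matrix.det_one,
    RCLike.star_def, Complex.mul_conj'] at h
  have : ‖E.det‖ ^ 2 = 1 := by exact_mod_cast h
  nlinarith [norm_nonneg E.det]

theorem frobSq_mul_mul_transpose {E F : Matrix (Fin 2) (Fin 2) ℂ}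
    (hE : E ∈ Matrix.unitaryGroup (Fin 2) ℂ) (hF : F ∈ Matrix.unitaryGroup (Fin 2) ℂ)
    (T : Matrix (Fin 2) (Fin 2) ℂ) : frobSq (E * T * Fᵀ) = frobSq T := by
  have hE1 : Eᴴ * E = 1 := Matrix.mem_unitaryGroup_iff'.1 hE
  have hF1 : Fᴴ * F = 1 := Matrix.mem_unitaryGroup_iff'.1 hF
  have hF2 : Fᵀ * Fᵀᴴ = 1 := by
    have := congrArg Matrix.transpose hF1
    rwa [Matrix.transpose_mul, Matrix.transpose_one] at this
  have : (frobSq (E * T * Fᵀ) : ℂ) = frobSq T := by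
    rw [frobSq_eq_trace, frobSq_eq_trace, Matrix.conjTranspose_mul, Matrix.conjTranspose_mul]
    calc (E * T * Fᵀ * (Fᵀᴴ * (Tᴴ * Eᴴ))).trace
        = (E * (T * (Fᵀ * Fᵀᴴ) * Tᴴ) * Eᴴ).trace := by simp only [Matrix.mul_assoc]
      _ = (Eᴴ * E * (T * Tᴴ)).trace := by
          rw [hF2, Matrix.mul_one, Matrix.trace_mul_comm, Matrix.mul_assoc]
      _ = (T * Tᴴ).trace := by rw [hE1, Matrix.one_mul]
  exact_mod_cast this

theorem singularGapSq_congr {E : Matrix (Fin 2) (Fin 2) ℂ}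
    (hE : E ∈ Matrix.unitaryGroup (Fin 2) ℂ) (T : Matrix (Fin 2) (Fin 2) ℂ) :
    singularGapSq (E * T * Eᵀ) = singularGapSq T := by
  have h2 : ‖(E * T * Eᵀ).det‖ = ‖T.det‖ := by
    rw [Matrix.det_mul, Matrix.det_mul, Matrix.det_transpose, norm_mul, norm_mul,
      norm_det_of_unitary hE]
    ring
  rw [singularGapSq, frobSq_mul_mul_transpose hE hE, h2, singularGapSq]

theorem singularGapSq_smul (z : ℂ) (T : Matrix (Fin 2) (Fin 2) ℂ) :
    singularGapSq (z • T) = ‖z‖ ^ 2 * singularGapSq T := by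
  rw [singularGapSq, frobSq_smul, Matrix.det_smul, norm_mul, norm_pow, Fintype.card_fin,
    singularGapSq]
  ring

theorem singularGapSq_diagonal {s₀ s₁ : ℝ} (h1 : 0 ≤ s₁) (h0 : s₁ ≤ s₀) :
    singularGapSq !![(s₀ : ℂ), 0; 0, -(s₁ : ℂ)] = (s₀ - s₁) ^ 2 := by
  simp [singularGapSq, frobSq, Fin.sum_univ_two, Matrix.det_fin_two, abs_of_nonneg h1,
    abs_of_nonneg (h1.trans h0)]
  ring

/-! ### Optimal resolutions of the identity -/

theorem vecMulVec_vecMul (v : Fin 2 → ℂ) (A : Matrix (Fin 2) (Fin 2) ℂ) :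
    vecMulVec (star (v ᵥ* A)) (v ᵥ* A) = Aᴴ * vecMulVec (star v) v * A := by
  rw [Matrix.mul_vecMulVec, Matrix.vecMulVec_mul, Matrix.star_vecMul]

theorem sum_vecMulVec_row {E : Matrix (Fin 2) (Fin 2) ℂ}
    (hE : E ∈ Matrix.unitaryGroup (Fin 2) ℂ) : ∑ k, vecMulVec (star (E k)) (E k) = 1 := by
  rw [← Matrix.mem_unitaryGroup_iff'.1 hE]
  ext i j
  simp [Matrix.sum_apply, Matrix.mul_apply, vecMulVec_apply, Matrix.star_apply]

/-- If the quadratic form `det` of a pair is diagonal with entries `s₀ ≥ 0` and `-s₁ ≤ 0`, then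
`|det|` dominates the Hermitian form `diag (s₀, -s₁)`, hence its sum over a resolution of the
identity is at least the trace `s₀ - s₁`. -/
theorem sub_le_sum_norm_det {w : Fin 2 → Matrix (Fin 2) (Fin 2) ℂ} {s₀ s₁ : ℝ}
    (h0 : 0 ≤ s₀) (h1 : 0 ≤ s₁) (hw : detForm w = !![(s₀ : ℂ), 0; 0, -(s₁ : ℂ)])
    {ι : Type*} [Fintype ι] {V : ι → Fin 2 → ℂ} (hV : ∑ k, vecMulVec (star (V k)) (V k) = 1) :
    s₀ - s₁ ≤ ∑ k, ‖(mix w (V k)).det‖ := by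
  have hnorm : ∀ i, ∑ k, ‖V k i‖ ^ 2 = 1 := by
    intro i
    have h := congrFun₂ hV i i
    simp only [Matrix.sum_apply, vecMulVec_apply, Pi.star_apply, RCLike.star_def,
      Complex.conj_mul', Matrix.one_apply_eq] at h
    exact_mod_cast h
  have hle : ∀ k, s₀ * ‖V k 0‖ ^ 2 - s₁ * ‖V k 1‖ ^ 2 ≤ ‖(mix w (V k)).det‖ := by
    intro k
    have hdet : (mix w (V k)).det = V k 0 ^ 2 * s₀ - V k 1 ^ 2 * s₁ := by
      rw [det_mix, hw]
      simp
      ring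
    rw [hdet]
    refine le_trans (le_of_eq ?_) (norm_sub_norm_le _ _)
    simp [abs_of_nonneg h0, abs_of_nonneg h1]
    ring
  calc s₀ - s₁ = s₀ * ∑ k, ‖V k 0‖ ^ 2 - s₁ * ∑ k, ‖V k 1‖ ^ 2 := by rw [hnorm, hnorm]; ring
    _ = ∑ k, (s₀ * ‖V k 0‖ ^ 2 - s₁ * ‖V k 1‖ ^ 2) := by
        rw [Finset.mul_sum, Finset.mul_sum, Finset.sum_sub_distrib]
    _ ≤ _ := Finset.sum_le_sum fun k _ => hle k

theorem rotation_mem_unitaryGroup {c s : ℝ} (h : c ^ 2 + s ^ 2 = 1) :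
    !![(c : ℂ), s; -s, c] ∈ Matrix.unitaryGroup (Fin 2) ℂ := by
  have := unitary_of_row (x := c) (y := s) (by simpa using h)
  simpa using this

/-- A rotation makes `|det|` proportional to the squared norm on both members of a pair, the
factor being the gap `s₀ - s₁`: the quadratic form `det - (s₀ - s₁) ‖·‖²` is real and traceless on
the real plane spanned by the pair, so that it has two orthonormal isotropic vectors. -/
theorem exists_rotation_norm_det_eq {w : Fin 2 → Matrix (Fin 2) (Fin 2) ℂ} {s₀ s₁ : ℝ}
    (h1 : s₁ ≤ s₀) (hw : detForm w = !![(s₀ : ℂ), 0; 0, -(s₁ : ℂ)])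
    (hn : ∑ k, frobSq (w k) = 1) :
    ∃ R ∈ Matrix.unitaryGroup (Fin 2) ℂ, ∀ k,
      ‖(rotate R w k).det‖ = (s₀ - s₁) * frobSq (rotate R w k) := by
  set t := s₀ - s₁ with ht
  set r : ℝ := (∑ i, ∑ j, w 0 i j * star (w 1 i j)).re with hr
  obtain ⟨c, s, hcs, hiso⟩ := exists_isotropic (s₀ - t * frobSq (w 0)) (t * r)
  rw [Fin.sum_univ_two] at hn
  have hnorm : ∀ a b : ℝ, frobSq (mix w ![(a : ℂ), b]) =
      a ^ 2 * frobSq (w 0) + b ^ 2 * frobSq (w 1) + 2 * (a * b) * r := by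
    intro a b
    have hadd : ∀ x y : ℂ, ‖(a : ℂ) * x + b * y‖ ^ 2 =
        a ^ 2 * ‖x‖ ^ 2 + b ^ 2 * ‖y‖ ^ 2 + 2 * (a * b) * (x * star y).re := by
      intro x y
      rw [← Complex.normSq_eq_norm_sq, ← Complex.normSq_eq_norm_sq, ← Complex.normSq_eq_norm_sq,
        Complex.normSq_add, Complex.normSq_mul, Complex.normSq_mul, Complex.normSq_ofReal,
        Complex.normSq_ofReal]
      simp
      ring
    simp only [frobSq, mix, Matrix.add_apply, Matrix.smul_apply, smul_eq_mul, Fin.sum_univ_two,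
      Matrix.cons_val_zero, Matrix.cons_val_one, hadd, hr, Complex.add_re]
    ring
  have hdet : ∀ a b : ℝ, (mix w ![(a : ℂ), b]).det = ((a ^ 2 * s₀ - b ^ 2 * s₁ : ℝ) : ℂ) := by
    intro a b
    rw [det_mix, hw]
    simp
    ring
  have key : ∀ a b : ℝ, a ^ 2 * s₀ - b ^ 2 * s₁ = t * frobSq (mix w ![(a : ℂ), b]) →
      ‖(mix w ![(a : ℂ), b]).det‖ = t * frobSq (mix w ![(a : ℂ), b]) := by
    intro a b h
    rw [hdet, h, Complex.norm_real, Real.norm_of_nonneg]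
    exact mul_nonneg (by linarith) (frobSq_nonneg _)
  refine ⟨_, rotation_mem_unitaryGroup hcs, ?_⟩
  have hs2 : s ^ 2 = 1 - c ^ 2 := by linarith
  have hf1 : frobSq (w 1) = 1 - frobSq (w 0) := by linarith
  rw [Fin.forall_fin_two]
  constructor
  · apply key c s
    rw [hnorm, hf1]
    rw [hs2] at hiso ⊢
    linear_combination hiso - (1 - c ^ 2) * ht
  · have := key (-s) c
    push_cast at this
    apply this
    have h' := hnorm (-s) c
    push_cast at h'
    rw [h', hf1]
    have : (-s) ^ 2 = 1 - c ^ 2 := by rw [neg_sq, hs2]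
    rw [hs2] at hiso
    rw [this]
    linear_combination -hiso - c ^ 2 * ht

/-- Of a pair of total squared norm one, some orthonormal combinations are both nonzero; if the
determinant is proportional to the squared norm on the pair, it can be kept so. -/
theorem exists_rotation_pos {w : Fin 2 → Matrix (Fin 2) (Fin 2) ℂ} {t : ℝ}
    (hn : ∑ k, frobSq (w k) = 1) (hw : ∀ k, ‖(w k).det‖ = t * frobSq (w k)) :
    ∃ R ∈ Matrix.unitaryGroup (Fin 2) ℂ, ∀ k, 0 < frobSq (rotate R w k) ∧
      ‖(rotate R w k).det‖ = t * frobSq (rotate R w k) := by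
  by_cases hpos : ∀ k, 0 < frobSq (w k)
  · exact ⟨1, one_mem _, fun k => by rw [rotate_one]; exact ⟨hpos k, hw k⟩⟩
  push Not at hpos
  -- One member vanishes, and the balanced combinations are multiples of the other.
  have hq : ((1 / √2 : ℝ) : ℂ) ^ 2 = 1 / 2 := by
    norm_cast
    rw [div_pow, Real.sq_sqrt (by norm_num)]
    norm_num
  have hq' : (1 / √2 : ℝ) ^ 2 = 1 / 2 := by
    rw [div_pow, Real.sq_sqrt (by norm_num)]
    norm_num
  set q : ℝ := 1 / √2 with hqdef
  have hR := rotation_mem_unitaryGroup (c := q) (s := q) (by rw [hq']; norm_num)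
  have scaled : ∀ (X : Matrix (Fin 2) (Fin 2) ℂ) (z : ℂ), ‖z‖ ^ 2 = 1 / 2 → 0 < frobSq X →
      ‖X.det‖ = t * frobSq X →
      0 < frobSq (z • X) ∧ ‖(z • X).det‖ = t * frobSq (z • X) := by
    intro X z hz h1 h2
    rw [frobSq_smul, Matrix.det_smul, hz]
    refine ⟨by linarith, ?_⟩
    rw [norm_mul, h2, norm_pow, Fintype.card_fin, hz]
    ring
  have hzq : ‖(q : ℂ)‖ ^ 2 = 1 / 2 := by simpa using hq'
  have hzq' : ‖-(q : ℂ)‖ ^ 2 = 1 / 2 := by simpa using hq'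
  refine ⟨_, hR, ?_⟩
  obtain ⟨k, hk⟩ := hpos
  have hk0 : w k = 0 := frobSq_eq_zero (le_antisymm hk (frobSq_nonneg _))
  rw [Fin.sum_univ_two] at hn
  fin_cases k
  · simp only [Fin.zero_eta] at hk0
    have h1 : 0 < frobSq (w 1) := by
      rw [hk0] at hn
      simp [frobSq] at hn ⊢
      linarith
    simp only [Fin.forall_fin_two, rotate, mix, hk0, smul_zero, zero_add]
    exact ⟨scaled _ _ hzq h1 (hw 1), scaled _ _ hzq h1 (hw 1)⟩
  · simp only [Fin.mk_one] at hk0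
    have h0 : 0 < frobSq (w 0) := by
      rw [hk0] at hn
      simp [frobSq] at hn ⊢
      linarith
    simp only [Fin.forall_fin_two, rotate, mix, hk0, smul_zero, add_zero]
    exact ⟨scaled _ _ hzq h0 (hw 0), scaled _ _ hzq' h0 (hw 0)⟩

/-- The number `t` is the least value of `∑ₖ |det (mix w (V k))|` over the resolutions of the
identity `V`, and it is attained by an orthonormal basis on which `|det|` is proportional to the
squared norm; it is also the gap between the singular values of the form `det`. -/
structure IsDetGap (w : Fin 2 → Matrix (Fin 2) (Fin 2) ℂ) (t : ℝ) : Prop where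
  nonneg : 0 ≤ t
  sq_eq : t ^ 2 = singularGapSq (detForm w)
  le_sum : ∀ (ι : Type) [Fintype ι] (V : ι → Fin 2 → ℂ),
    ∑ k, vecMulVec (star (V k)) (V k) = 1 → t ≤ ∑ k, ‖(mix w (V k)).det‖
  attained : ∃ B ∈ Matrix.unitaryGroup (Fin 2) ℂ, ∀ k, 0 < frobSq (rotate B w k) ∧
    ‖(rotate B w k).det‖ = t * frobSq (rotate B w k)

theorem exists_isDetGap {w : Fin 2 → Matrix (Fin 2) (Fin 2) ℂ} (hn : ∑ k, frobSq (w k) = 1) :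
    ∃ t, IsDetGap w t := by
  obtain ⟨E, hE, s₀, s₁, h1, h01, hT⟩ := exists_takagi (detForm w) (detForm_symm w)
  have hT' : detForm (rotate E w) = !![(s₀ : ℂ), 0; 0, -(s₁ : ℂ)] := by
    rw [detForm_rotate, hT]
  refine ⟨s₀ - s₁, by linarith, ?_, ?_, ?_⟩
  · rw [← singularGapSq_congr hE, hT, singularGapSq_diagonal h1 h01]
  · intro ι _ V hV
    have hEE : E * Eᴴ = 1 := Matrix.mem_unitaryGroup_iff.1 hE
    have hEE' : Eᴴ * E = 1 := Matrix.mem_unitaryGroup_iff'.1 hE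
    have := sub_le_sum_norm_det (V := fun k => V k ᵥ* Eᴴ) (h1.trans h01) h1 hT' (by
      simp only [vecMulVec_vecMul]
      rw [← Finset.sum_mul, ← Finset.mul_sum, hV, Matrix.mul_one,
        Matrix.conjTranspose_conjTranspose, hEE])
    simpa only [mix_rotate, Matrix.vecMul_vecMul, hEE', Matrix.vecMul_one] using this
  · obtain ⟨R, hR, hR'⟩ := exists_rotation_norm_det_eq h01 hT' (by rw [frobSq_rotate hE, hn])
    obtain ⟨Q, hQ, hQ'⟩ := exists_rotation_pos
      (by rw [frobSq_rotate hR, frobSq_rotate hE, hn]) hR'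
    refine ⟨Q * (R * E), mul_mem hQ (mul_mem hR hE), ?_⟩
    rw [← rotate_rotate, ← rotate_rotate]
    exact hQ'

/-! ### Qubit states -/

theorem four_mul_det_le {X : Matrix (Fin 2) (Fin 2) ℂ} (hX : X.IsHermitian) :
    4 * X.det.re ≤ X.trace.re ^ 2 := by
  have h10 : X 1 0 = star (X 0 1) := (hX.apply 1 0).symm
  have h00 : (X 0 0).im = 0 := Complex.conj_eq_iff_im.1 (hX.apply 0 0)
  have h11 : (X 1 1).im = 0 := Complex.conj_eq_iff_im.1 (hX.apply 1 1)
  rw [Matrix.det_fin_two, Matrix.trace_fin_two, h10]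
  simp [h00, h11]
  nlinarith [sq_nonneg ((X 0 0).re - (X 1 1).re), sq_nonneg (X 0 1).re, sq_nonneg (X 0 1).im]

theorem det_eq_ofReal_re {X : Matrix (Fin 2) (Fin 2) ℂ} (hX : X.PosSemidef) :
    X.det = (X.det.re : ℂ) ∧ 0 ≤ X.det.re := by
  have h := Complex.nonneg_iff.1 hX.det_nonneg
  exact ⟨Complex.ext rfl (by simp [h.2]), h.1⟩

/-- The entropy of a qubit state is a function of its determinant. -/
theorem entropy_eq_of_trace_eq_one {X : Matrix (Fin 2) (Fin 2) ℂ} (hX : X.PosSemidef)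
    (htr : X.trace = 1) : entropy X = entropyOfConcurrence (2 * √X.det.re) := by
  obtain ⟨hdet, hd0⟩ := det_eq_ofReal_re hX
  have hd1 : 4 * X.det.re ≤ 1 := by
    have := four_mul_det_le hX.isHermitian
    rw [htr] at this
    simpa using this
  set d := X.det.re
  have hs := Real.sq_sqrt (show 0 ≤ 1 - 4 * d by linarith)
  set s := √(1 - 4 * d) with hsdef
  have hchar : X.charpoly = (Polynomial.X - Polynomial.C (((1 + s) / 2 : ℝ) : ℂ)) *
      (Polynomial.X - Polynomial.C (((1 - s) / 2 : ℝ) : ℂ)) := by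
    rw [Matrix.charpoly_fin_two, htr, hdet]
    have h1 : ((1 : ℂ)) = (((1 + s) / 2 : ℝ) : ℂ) + (((1 - s) / 2 : ℝ) : ℂ) := by
      push_cast; ring
    have h2 : (d : ℂ) = (((1 + s) / 2 : ℝ) : ℂ) * (((1 - s) / 2 : ℝ) : ℂ) := by
      rw [← Complex.ofReal_mul]
      congr 1
      linarith
    rw [h1, h2, Polynomial.C_add, Polynomial.C_mul]
    ring
  have hroots : X.charpoly.roots = {(((1 + s) / 2 : ℝ) : ℂ), (((1 - s) / 2 : ℝ) : ℂ)} := by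
    rw [hchar, Polynomial.roots_mul (mul_ne_zero (Polynomial.X_sub_C_ne_zero _)
      (Polynomial.X_sub_C_ne_zero _)), Polynomial.roots_X_sub_C, Polynomial.roots_X_sub_C]
    rfl
  rw [entropy, hroots, entropyOfConcurrence, mul_pow, Real.sq_sqrt hd0]
  norm_num only
  rw [← hsdef, binH]
  simp only [Multiset.insert_eq_cons, Multiset.map_cons, Multiset.map_singleton,
    Multiset.sum_cons, Multiset.sum_singleton, Complex.ofReal_re]
  have : 1 - (1 + s) / 2 = (1 - s) / 2 := by ring
  rw [this]
  ring

theorem trace_mul_conjTranspose_re {m n : Type*} [Fintype m] [Fintype n] (X : Matrix m n ℂ) :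
    (X * Xᴴ).trace.re = frobSq X := by
  rw [← frobSq_eq_trace, Complex.ofReal_re]

theorem det_mul_conjTranspose_re (X : Matrix (Fin 2) (Fin 2) ℂ) :
    (X * Xᴴ).det.re = ‖X.det‖ ^ 2 := by
  rw [Matrix.det_mul, Matrix.det_conjTranspose, RCLike.star_def, Complex.mul_conj']
  norm_cast

theorem two_mul_norm_det_le (X : Matrix (Fin 2) (Fin 2) ℂ) : 2 * ‖X.det‖ ≤ frobSq X := by
  have h := four_mul_det_le (posSemidef_self_mul_conjTranspose X).isHermitian
  rw [det_mul_conjTranspose_re, trace_mul_conjTranspose_re] at h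
  apply le_of_sq_le_sq _ (frobSq_nonneg X)
  linarith

/-- Superadditivity of the square root of the determinant on positive `2 × 2` matrices, by the
Cauchy–Binet formula for `(P | Q)` and the Plücker relation between its minors. -/
theorem add_norm_det_le_sqrt_det (P Q : Matrix (Fin 2) (Fin 2) ℂ) :
    ‖P.det‖ + ‖Q.det‖ ≤ √(P * Pᴴ + Q * Qᴴ).det.re := by
  apply Real.le_sqrt_of_sq_le
  let m : Fin 2 → Fin 2 → ℂ := fun a b => P 0 a * Q 1 b - P 1 a * Q 0 b
  have hcb : (P * Pᴴ + Q * Qᴴ).det.re = ‖P.det‖ ^ 2 + ‖Q.det‖ ^ 2 +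
      (‖m 0 0‖ ^ 2 + ‖m 1 1‖ ^ 2) + (‖m 0 1‖ ^ 2 + ‖m 1 0‖ ^ 2) := by
    have : (P * Pᴴ + Q * Qᴴ).det = ((‖P.det‖ ^ 2 + ‖Q.det‖ ^ 2 +
      (‖m 0 0‖ ^ 2 + ‖m 1 1‖ ^ 2) + (‖m 0 1‖ ^ 2 + ‖m 1 0‖ ^ 2) : ℝ) : ℂ) := by
      push_cast
      simp only [← Complex.mul_conj', m, Matrix.det_fin_two, Matrix.add_apply, Matrix.mul_apply,
        Fin.sum_univ_two, Matrix.conjTranspose_apply, RCLike.star_def, map_sub, map_mul]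
      ring
    rw [this, Complex.ofReal_re]
  have hpl : ‖P.det‖ * ‖Q.det‖ ≤ ‖m 0 0‖ * ‖m 1 1‖ + ‖m 0 1‖ * ‖m 1 0‖ := by
    rw [← norm_mul, ← norm_mul, ← norm_mul]
    have : P.det * Q.det = m 0 0 * m 1 1 - m 0 1 * m 1 0 := by
      simp only [m, Matrix.det_fin_two]
      ring
    rw [this]
    exact norm_sub_le _ _
  rw [hcb]
  nlinarith [sq_nonneg (‖m 0 0‖ - ‖m 1 1‖), sq_nonneg (‖m 0 1‖ - ‖m 1 0‖)]

/-! ### Measurements on a purification -/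

/-- The vector `Ψ` as a pair, indexed by the basis of `A`, of matrices from `C` to `B`. -/
def slice (Ψ : Fin 2 × Fin 2 × Fin 2 → ℂ) (i : Fin 2) : Matrix (Fin 2) (Fin 2) ℂ :=
  Matrix.of fun j c => Ψ (i, j, c)

theorem traceFst_mul_kronecker_one (Ψ : Fin 2 × Fin 2 × Fin 2 → ℂ) (v : Fin 2 → ℂ) :
    traceFst (reducedAB Ψ * (vecMulVec (star v) v ⊗ₖ (1 : Matrix (Fin 2) (Fin 2) ℂ))) =
      mix (slice Ψ) v * (mix (slice Ψ) v)ᴴ := by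
  ext j k
  fin_cases j <;> fin_cases k <;>
    simp [traceFst, traceSnd, reducedAB, pureState, vecMulVec_apply, Matrix.mul_apply, slice, mix,
      Fintype.sum_prod_type, Fin.sum_univ_two, Matrix.kroneckerMap_apply] <;>
    ring

theorem traceFst_add {m n : Type*} [Fintype m] (X Y : Matrix (m × n) (m × n) ℂ) :
    traceFst (X + Y) = traceFst X + traceFst Y := by
  ext j k
  simp [traceFst, Finset.sum_add_distrib]

theorem trace_traceFst {m n : Type*} [Fintype m] [Fintype n] (X : Matrix (m × n) (m × n) ℂ) :
    (traceFst X).trace = X.trace := by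
  simp [traceFst, Matrix.trace, Fintype.sum_prod_type_right]

theorem sum_frobSq_slice {Ψ : Fin 2 × Fin 2 × Fin 2 → ℂ} (h : (reducedAB Ψ).trace = 1) :
    ∑ i, frobSq (slice Ψ i) = 1 := by
  have : ((∑ i, frobSq (slice Ψ i) : ℝ) : ℂ) = 1 := by
    rw [← h]
    simp [frobSq, slice, reducedAB, traceSnd, pureState, Matrix.trace, vecMulVec_apply,
      Fintype.sum_prod_type, Complex.mul_conj']
  exact_mod_cast this

theorem outcomeProb_eq (ρ : Matrix (Fin 2 × Fin 2) (Fin 2 × Fin 2) ℂ)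
    (M : Matrix (Fin 2) (Fin 2) ℂ) :
    outcomeProb ρ M = (traceFst (ρ * (M ⊗ₖ (1 : Matrix (Fin 2) (Fin 2) ℂ)))).trace.re := by
  rw [trace_traceFst, outcomeProb]

theorem sum_outcomeProb {ρ : Matrix (Fin 2 × Fin 2) (Fin 2 × Fin 2) ℂ} (hρ : ρ.trace = 1)
    {ι : Type*} [Fintype ι] {M : ι → Matrix (Fin 2) (Fin 2) ℂ} (hM : ∑ k, M k = 1) :
    ∑ k, outcomeProb ρ (M k) = 1 := by
  have : ∑ k, M k ⊗ₖ (1 : Matrix (Fin 2) (Fin 2) ℂ) = 1 := by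
    rw [← Matrix.one_kronecker_one, ← hM]
    ext ⟨a, b⟩ ⟨c, d⟩
    simp [Matrix.sum_apply, Matrix.kroneckerMap_apply, Finset.sum_mul]
  simp only [outcomeProb]
  rw [← Complex.re_sum, ← Matrix.trace_sum, ← Finset.mul_sum, this, Matrix.mul_one, hρ,
    Complex.one_re]

/-- A POVM element is the sum of two rank-one ones, and the conditional state is the sum of the
corresponding pure ones. -/
theorem exists_traceFst_eq {M : Matrix (Fin 2) (Fin 2) ℂ} (hM : M.PosSemidef) :
    ∃ B : Matrix (Fin 2) (Fin 2) ℂ, M = ∑ r, vecMulVec (star (B r)) (B r) ∧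
      ∀ Ψ : Fin 2 × Fin 2 × Fin 2 → ℂ,
      traceFst (reducedAB Ψ * (M ⊗ₖ (1 : Matrix (Fin 2) (Fin 2) ℂ))) =
        mix (slice Ψ) (B 0) * (mix (slice Ψ) (B 0))ᴴ +
          mix (slice Ψ) (B 1) * (mix (slice Ψ) (B 1))ᴴ := by
  obtain ⟨B, hB⟩ : ∃ B, M = star B * B := by
    open scoped MatrixOrder Matrix.Norms.L2Operator in
    exact CStarAlgebra.nonneg_iff_eq_star_mul_self.mp hM.nonneg
  have hsum : M = ∑ r, vecMulVec (star (B r)) (B r) := by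
    rw [hB]
    ext i j
    simp [Matrix.mul_apply, vecMulVec_apply, Matrix.star_apply]
  refine ⟨B, hsum, fun Ψ => ?_⟩
  rw [hsum, Fin.sum_univ_two, Matrix.add_kronecker, Matrix.mul_add, traceFst_add,
    traceFst_mul_kronecker_one, traceFst_mul_kronecker_one]

/-- The conditional state of an outcome of positive probability, in terms of the unnormalised
state `X`. -/
theorem postState_data {ρ : Matrix (Fin 2 × Fin 2) (Fin 2 × Fin 2) ℂ}
    {M X : Matrix (Fin 2) (Fin 2) ℂ}
    (hX : traceFst (ρ * (M ⊗ₖ (1 : Matrix (Fin 2) (Fin 2) ℂ))) = X) (hpsd : X.PosSemidef)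
    (hp : 0 < outcomeProb ρ M) :
    entropy (postState ρ M) =
        entropyOfConcurrence (2 * √X.det.re / outcomeProb ρ M) ∧
      2 * √X.det.re / outcomeProb ρ M ∈ Set.Icc (0 : ℝ) 1 := by
  have hpX : outcomeProb ρ M = X.trace.re := by rw [outcomeProb_eq, hX]
  have htr : X.trace = (X.trace.re : ℂ) :=
    Complex.ext rfl (by simp [(Complex.nonneg_iff.1 hpsd.trace_nonneg).2.symm])
  have hpost : postState ρ M = (outcomeProb ρ M)⁻¹ • X := by rw [postState, hX]
  set p := outcomeProb ρ M
  have hdet : (p⁻¹ • X).det.re = X.det.re / p ^ 2 := by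
    have : (p⁻¹ • X).det = ((p⁻¹ ^ 2 : ℝ) : ℂ) * X.det := by
      simp [Matrix.det_fin_two]
    rw [this, Complex.re_ofReal_mul]
    field_simp
  have hsqrt : √(X.det.re / p ^ 2) = √X.det.re / p := by
    rw [Real.sqrt_div' _ (sq_nonneg p), Real.sqrt_sq hp.le]
  constructor
  · rw [hpost, entropy_eq_of_trace_eq_one (hpsd.smul (inv_nonneg.2 hp.le)), hdet, hsqrt,
      mul_div_assoc]
    rw [Matrix.trace_smul, htr, ← hpX, Complex.real_smul, ← Complex.ofReal_mul,
      inv_mul_cancel₀ hp.ne', Complex.ofReal_one]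
  · refine ⟨by positivity, ?_⟩
    rw [div_le_one hp]
    apply le_of_sq_le_sq _ hp.le
    rw [mul_pow, Real.sq_sqrt (det_eq_ofReal_re hpsd).2, hpX]
    have := four_mul_det_le hpsd.isHermitian
    linarith

theorem isVonNeumann_row {B : Matrix (Fin 2) (Fin 2) ℂ}
    (hB : B ∈ Matrix.unitaryGroup (Fin 2) ℂ) :
    IsVonNeumann fun k => vecMulVec (star (B k)) (B k) := by
  have hsum := sum_vecMulVec_row hB
  have hone : ∀ k, B k ⬝ᵥ star (B k) = 1 := by
    intro k
    have := congrFun₂ (Matrix.mem_unitaryGroup_iff.1 hB) k k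
    simpa [Matrix.mul_apply, dotProduct] using this
  refine ⟨fun k => ⟨(posSemidef_vecMulVec_star_self _).isHermitian, ?_, ?_⟩, hsum⟩
  · rw [Matrix.vecMulVec_mul_vecMulVec, hone k, one_smul]
  · refine le_antisymm (Matrix.rank_vecMulVec_le _ _) (Nat.one_le_iff_ne_zero.2 fun h0 => ?_)
    rw [Matrix.rank, Submodule.finrank_eq_zero, LinearMap.range_eq_bot] at h0
    have h1 := LinearMap.congr_fun h0 (star (B k))
    rw [Matrix.mulVecLin_apply, Matrix.vecMulVec_mulVec, hone k] at h1
    have h2 := hone k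
    simp only [MulOpposite.op_one, one_smul, LinearMap.zero_apply] at h1
    simp [h1] at h2

/-- The ensemble induced by a POVM, as weights and concurrences of the conditional states: the
average concurrence is at least that of the complementary state. -/
theorem exists_ensemble_of_povm {Ψ : Fin 2 × Fin 2 × Fin 2 → ℂ} (htr : (reducedAB Ψ).trace = 1)
    {t : ℝ} (ht : IsDetGap (slice Ψ) t) {n : ℕ} {M : Fin n → Matrix (Fin 2) (Fin 2) ℂ}
    (hM : IsPOVM M) :
    ∃ x : Fin n → ℝ, (∀ k, 0 ≤ outcomeProb (reducedAB Ψ) (M k)) ∧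
      ∑ k, outcomeProb (reducedAB Ψ) (M k) = 1 ∧ (∀ k, x k ∈ Set.Icc (0 : ℝ) 1) ∧
      (∀ k, 0 < outcomeProb (reducedAB Ψ) (M k) →
        entropy (postState (reducedAB Ψ) (M k)) = entropyOfConcurrence (x k)) ∧
      2 * t ≤ ∑ k, outcomeProb (reducedAB Ψ) (M k) * x k := by
  choose B hB hX using fun k => exists_traceFst_eq (hM.1 k)
  replace hX := fun k => hX k Ψ
  set φ : Fin n → Fin 2 → Matrix (Fin 2) (Fin 2) ℂ := fun k r => mix (slice Ψ) (B k r) with hφ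
  set X : Fin n → Matrix (Fin 2) (Fin 2) ℂ := fun k =>
    φ k 0 * (φ k 0)ᴴ + φ k 1 * (φ k 1)ᴴ with hXdef
  set p : Fin n → ℝ := fun k => outcomeProb (reducedAB Ψ) (M k) with hp
  have hpsd : ∀ k, (X k).PosSemidef := fun k =>
    (posSemidef_self_mul_conjTranspose _).add (posSemidef_self_mul_conjTranspose _)
  have hpeq : ∀ k, p k = frobSq (φ k 0) + frobSq (φ k 1) := by
    intro k
    rw [hp]
    simp only
    rw [outcomeProb_eq, hX, Matrix.trace_add, Complex.add_re, trace_mul_conjTranspose_re,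
      trace_mul_conjTranspose_re]
  have hp0 : ∀ k, 0 ≤ p k := fun k => by
    rw [hpeq]; exact add_nonneg (frobSq_nonneg _) (frobSq_nonneg _)
  -- Outcomes of probability zero get the value `0`, by division by zero.
  refine ⟨fun k => 2 * √(X k).det.re / p k, hp0, sum_outcomeProb htr hM.2, fun k => ?_,
    fun k hk => (postState_data (hX k) (hpsd k) hk).1, ?_⟩
  · rcases (hp0 k).eq_or_lt with h | h
    · simp [← h]
    · exact (postState_data (hX k) (hpsd k) h).2
  · have hV : ∑ q : Fin n × Fin 2, vecMulVec (star (B q.1 q.2)) (B q.1 q.2) = 1 := by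
      rw [Fintype.sum_prod_type, ← hM.2]
      exact Finset.sum_congr rfl fun k _ => (hB k).symm
    have hle := ht.le_sum (Fin n × Fin 2) (fun q => B q.1 q.2) hV
    rw [Fintype.sum_prod_type] at hle
    calc 2 * t ≤ 2 * ∑ k, ∑ r, ‖(φ k r).det‖ := by linarith
      _ = ∑ k, 2 * ∑ r, ‖(φ k r).det‖ := Finset.mul_sum _ _ _
      _ ≤ _ := Finset.sum_le_sum fun k _ => ?_
    rw [Fin.sum_univ_two]
    change 2 * (‖(φ k 0).det‖ + ‖(φ k 1).det‖) ≤ p k * (2 * √(X k).det.re / p k)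
    rcases (hp0 k).eq_or_lt with h | h
    · have h0 := two_mul_norm_det_le (φ k 0)
      have h1 := two_mul_norm_det_le (φ k 1)
      have := hpeq k
      rw [← h, zero_mul]
      linarith
    · rw [mul_div_cancel₀ _ h.ne']
      have := add_norm_det_le_sqrt_det (φ k 0) (φ k 1)
      linarith

theorem avgEntropy_eq_sum {ρ : Matrix (Fin 2 × Fin 2) (Fin 2 × Fin 2) ℂ} {n : ℕ}
    {M : Fin n → Matrix (Fin 2) (Fin 2) ℂ} {x : Fin n → ℝ} (hp : ∀ k, 0 ≤ outcomeProb ρ (M k))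
    (hx : ∀ k, 0 < outcomeProb ρ (M k) →
      entropy (postState ρ (M k)) = entropyOfConcurrence (x k)) :
    avgEntropy ρ M = ∑ k, outcomeProb ρ (M k) * entropyOfConcurrence (x k) := by
  refine Finset.sum_congr rfl fun k _ => ?_
  rcases (hp k).eq_or_lt with h | h
  · rw [← h, zero_mul, zero_mul]
  · rw [hx k h]

theorem entropyOfConcurrence_le_avgEntropy {Ψ : Fin 2 × Fin 2 × Fin 2 → ℂ}
    (htr : (reducedAB Ψ).trace = 1) {t : ℝ} (ht : IsDetGap (slice Ψ) t) {n : ℕ}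
    {M : Fin n → Matrix (Fin 2) (Fin 2) ℂ} (hM : IsPOVM M) :
    entropyOfConcurrence (2 * t) ≤ avgEntropy (reducedAB Ψ) M := by
  obtain ⟨x, hp, hp1, hx, hent, hle⟩ := exists_ensemble_of_povm htr ht hM
  rw [avgEntropy_eq_sum hp hent]
  exact le_sum_of_convexOn strictConvexOn_entropyOfConcurrence.convexOn
    strictMonoOn_entropyOfConcurrence.monotoneOn hp hp1 hx (by linarith [ht.nonneg]) hle

/-- By the equality case of Jensen's inequality, the conditional states of a POVM attaining the
minimum have equal entropies. -/
theorem entropy_postState_eq_of_optimal {Ψ : Fin 2 × Fin 2 × Fin 2 → ℂ}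
    (htr : (reducedAB Ψ).trace = 1) {t : ℝ} (ht : IsDetGap (slice Ψ) t) {n : ℕ}
    {M : Fin n → Matrix (Fin 2) (Fin 2) ℂ} (hM : IsPOVM M)
    (hopt : avgEntropy (reducedAB Ψ) M ≤ entropyOfConcurrence (2 * t)) {j k : Fin n}
    (hj : 0 < outcomeProb (reducedAB Ψ) (M j)) (hk : 0 < outcomeProb (reducedAB Ψ) (M k)) :
    entropy (postState (reducedAB Ψ) (M j)) = entropy (postState (reducedAB Ψ) (M k)) := by
  obtain ⟨x, hp, hp1, hx, hent, hle⟩ := exists_ensemble_of_povm htr ht hM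
  rw [avgEntropy_eq_sum hp hent] at hopt
  rw [hent j hj, hent k hk, eq_of_sum_eq_of_strictConvexOn strictConvexOn_entropyOfConcurrence
    strictMonoOn_entropyOfConcurrence.monotoneOn hp hp1 hx (by linarith [ht.nonneg]) hle hopt hj hk]

theorem isPOVM_row {B : Matrix (Fin 2) (Fin 2) ℂ}
    (hB : B ∈ Matrix.unitaryGroup (Fin 2) ℂ) :
    IsPOVM fun k => vecMulVec (star (B k)) (B k) :=
  ⟨fun _ => posSemidef_vecMulVec_star_self _, sum_vecMulVec_row hB⟩

/-- The basis attaining the gap gives a von Neumann measurement with two outcomes of positive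
probability and conditional states of equal entropy, which attains the minimum. -/
theorem exists_optimal_isVonNeumann {Ψ : Fin 2 × Fin 2 × Fin 2 → ℂ}
    (htr : (reducedAB Ψ).trace = 1) {t : ℝ} (ht : IsDetGap (slice Ψ) t) :
    ∃ P : Fin 2 → Matrix (Fin 2) (Fin 2) ℂ, IsVonNeumann P ∧ IsPOVM P ∧
      avgEntropy (reducedAB Ψ) P = entropyOfConcurrence (2 * t) ∧
      (∀ k, 0 < outcomeProb (reducedAB Ψ) (P k)) ∧
      ∀ k, entropy (postState (reducedAB Ψ) (P k)) = entropyOfConcurrence (2 * t) := by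
  obtain ⟨B, hB, hB'⟩ := ht.attained
  have hprob : ∀ k, outcomeProb (reducedAB Ψ) (vecMulVec (star (B k)) (B k)) =
      frobSq (rotate B (slice Ψ) k) := by
    intro k
    rw [outcomeProb_eq, traceFst_mul_kronecker_one, trace_mul_conjTranspose_re, rotate]
  have hpos : ∀ k, 0 < outcomeProb (reducedAB Ψ) (vecMulVec (star (B k)) (B k)) :=
    fun k => by rw [hprob]; exact (hB' k).1
  have hent : ∀ k, entropy (postState (reducedAB Ψ) (vecMulVec (star (B k)) (B k))) =
      entropyOfConcurrence (2 * t) := by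
    intro k
    rw [(postState_data (traceFst_mul_kronecker_one Ψ (B k))
      (posSemidef_self_mul_conjTranspose _) (hpos k)).1, det_mul_conjTranspose_re,
      Real.sqrt_sq (norm_nonneg _), hprob]
    have h := hB' k
    rw [rotate] at h
    rw [rotate, h.2]
    congr 1
    have := h.1.ne'
    field_simp
  refine ⟨_, isVonNeumann_row hB, isPOVM_row hB, ?_, hpos, hent⟩
  rw [avgEntropy_eq_sum (x := fun _ => 2 * t) (fun k => (hpos k).le) (fun k _ => hent k),
    ← Finset.sum_mul, sum_outcomeProb htr (sum_vecMulVec_row hB), one_mul]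

/-! ### Pure-state decompositions of the complementary state -/

/-- A family of vectors with the same Gram sum as a linearly independent family is obtained from it
by an isometric mixing. -/
theorem exists_mixing {m n N : Type*} [Fintype m] [Fintype n] [Fintype N] [DecidableEq n]
    {Y : Matrix m n ℂ} {Φ : Matrix m N ℂ} (h : Φ * Φᴴ = Y * Yᴴ) (hY : (Yᴴ * Y).det ≠ 0) :
    ∃ V : Matrix n N ℂ, Φ = Y * V ∧ V * Vᴴ = 1 := by
  classical
  have hu : IsUnit (Yᴴ * Y).det := isUnit_iff_ne_zero.2 hY
  set G := Yᴴ * Y with hG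
  have hGh : Gᴴ = G := by simp [hG]
  have hGi : (G⁻¹)ᴴ = G⁻¹ := by rw [Matrix.conjTranspose_nonsing_inv, hGh]
  refine ⟨G⁻¹ * Yᴴ * Φ, ?_, ?_⟩
  · have hR : (1 - Y * G⁻¹ * Yᴴ) * Φ * ((1 - Y * G⁻¹ * Yᴴ) * Φ)ᴴ = 0 := by
      have hY0 : (1 - Y * G⁻¹ * Yᴴ) * Y = 0 := by
        rw [Matrix.sub_mul, Matrix.one_mul, Matrix.mul_assoc, ← hG, Matrix.mul_assoc,
          Matrix.nonsing_inv_mul _ hu, Matrix.mul_one, sub_self]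
      rw [Matrix.conjTranspose_mul]
      calc (1 - Y * G⁻¹ * Yᴴ) * Φ * (Φᴴ * (1 - Y * G⁻¹ * Yᴴ)ᴴ)
          = (1 - Y * G⁻¹ * Yᴴ) * (Φ * Φᴴ) * (1 - Y * G⁻¹ * Yᴴ)ᴴ := by
            simp only [Matrix.mul_assoc]
        _ = (1 - Y * G⁻¹ * Yᴴ) * Y * Yᴴ * (1 - Y * G⁻¹ * Yᴴ)ᴴ := by
            rw [h]; simp only [Matrix.mul_assoc]
        _ = 0 := by rw [hY0]; simp
    have := Matrix.self_mul_conjTranspose_eq_zero.1 hR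
    rw [Matrix.sub_mul, Matrix.one_mul, sub_eq_zero] at this
    simpa only [Matrix.mul_assoc] using this
  · calc G⁻¹ * Yᴴ * Φ * (G⁻¹ * Yᴴ * Φ)ᴴ = G⁻¹ * Yᴴ * (Φ * Φᴴ) * Y * G⁻¹ := by
          simp only [Matrix.conjTranspose_mul, Matrix.conjTranspose_conjTranspose, hGi,
            Matrix.mul_assoc]
      _ = G⁻¹ * (Yᴴ * Y) * (Yᴴ * Y) * G⁻¹ := by rw [h]; simp only [Matrix.mul_assoc]
      _ = 1 := by
          rw [← hG, Matrix.nonsing_inv_mul _ hu, Matrix.one_mul, Matrix.mul_nonsing_inv _ hu]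

/-- A vector of a bipartite system as a matrix. -/
def asMatrix (φ : Fin 2 × Fin 2 → ℂ) : Matrix (Fin 2) (Fin 2) ℂ := Matrix.of fun j c => φ (j, c)

theorem frobSq_asMatrix (φ : Fin 2 × Fin 2 → ℂ) : frobSq (asMatrix φ) = ∑ i, ‖φ i‖ ^ 2 := by
  rw [Fintype.sum_prod_type]
  rfl

theorem traceSnd_pureState (φ : Fin 2 × Fin 2 → ℂ) :
    traceSnd (pureState φ) = asMatrix φ * (asMatrix φ)ᴴ := by
  ext i j
  simp [traceSnd, pureState, vecMulVec_apply, asMatrix, Matrix.mul_apply]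

/-- An orthonormal basis of `A` decomposes the complementary state into the vectors that it leaves
on `BC`. -/
theorem reducedBC_eq_sum {B : Matrix (Fin 2) (Fin 2) ℂ}
    (hB : B ∈ Matrix.unitaryGroup (Fin 2) ℂ) (Ψ : Fin 2 × Fin 2 × Fin 2 → ℂ) :
    reducedBC Ψ = ∑ k, pureState fun x => rotate B (slice Ψ) k x.1 x.2 := by
  have h := Matrix.mem_unitaryGroup_iff'.1 hB
  have h00 := congrFun₂ h 0 0
  have h01 := congrFun₂ h 0 1
  have h10 := congrFun₂ h 1 0
  have h11 := congrFun₂ h 1 1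
  simp only [Matrix.star_eq_conjTranspose, Matrix.mul_apply, Fin.sum_univ_two,
    Matrix.conjTranspose_apply, Matrix.one_apply, RCLike.star_def] at h00 h01 h10 h11
  norm_num at h00 h01 h10 h11
  ext ⟨j, c⟩ ⟨k, d⟩
  simp only [reducedBC, traceFst, pureState, vecMulVec_apply, Matrix.of_apply, Matrix.sum_apply,
    Fin.sum_univ_two, rotate, mix, slice, Matrix.add_apply, Matrix.smul_apply, smul_eq_mul,
    Pi.star_apply, RCLike.star_def, map_add, map_mul]
  linear_combination
    -(Ψ (0, j, c) * (starRingEnd ℂ) (Ψ (0, k, d))) * h00 -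
    (Ψ (1, j, c) * (starRingEnd ℂ) (Ψ (1, k, d))) * h11 -
    (Ψ (1, j, c) * (starRingEnd ℂ) (Ψ (0, k, d))) * h01 -
    (Ψ (0, j, c) * (starRingEnd ℂ) (Ψ (1, k, d))) * h10

/-- The average of `|det|` over any pure-state decomposition of the complementary state is at least
the gap. -/
theorem le_sum_norm_det_of_decomposition {Ψ : Fin 2 × Fin 2 × Fin 2 → ℂ} {t : ℝ}
    (hn : ∑ i, frobSq (slice Ψ i) = 1) (ht : IsDetGap (slice Ψ) t) {N : ℕ} {p : Fin N → ℝ} {φ : Fin N → Fin 2 × Fin 2 → ℂ}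
    (hp : ∀ k, 0 ≤ p k) (hdec : reducedBC Ψ = ∑ k, p k • pureState (φ k)) :
    t ≤ ∑ k, p k * ‖(asMatrix (φ k)).det‖ := by
  set Φ : Matrix (Fin 2 × Fin 2) (Fin N) ℂ := Matrix.of fun x k => (√(p k) : ℂ) * φ k x with hΦ
  have hΦΦ : Φ * Φᴴ = reducedBC Ψ := by
    rw [hdec]
    ext x y
    simp only [hΦ, Matrix.mul_apply, Matrix.conjTranspose_apply, Matrix.of_apply,
      Matrix.sum_apply, Matrix.smul_apply, pureState, vecMulVec_apply, Pi.star_apply,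
      RCLike.star_def, map_mul, Complex.conj_ofReal, Complex.real_smul]
    refine Finset.sum_congr rfl fun k _ => ?_
    have : (√(p k) : ℂ) * √(p k) = p k := by
      rw [← Complex.ofReal_mul, Real.mul_self_sqrt (hp k)]
    rw [← this]
    ring
  have hdetΦ : ∀ k, p k * ‖(asMatrix (φ k)).det‖ = ‖(Matrix.of fun j c => Φ (j, c) k).det‖ := by
    intro k
    have : (Matrix.of fun j c => Φ (j, c) k) = (√(p k) : ℂ) • asMatrix (φ k) := by
      ext j c; simp [hΦ, asMatrix]
    rw [this, Matrix.det_smul, norm_mul, norm_pow, Complex.norm_real,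
      Real.norm_of_nonneg (Real.sqrt_nonneg _), Fintype.card_fin, Real.sq_sqrt (hp k)]
  simp only [hdetΦ]
  -- The columns of `Y` span the support of the complementary state.
  set Y : Matrix (Fin 2 × Fin 2) (Fin 2) ℂ := Matrix.of fun x i => Ψ (i, x.1, x.2) with hYdef
  have hYY : Y * Yᴴ = reducedBC Ψ := by
    ext x y
    simp [hYdef, Matrix.mul_apply, reducedBC, traceFst, pureState, vecMulVec_apply]
  by_cases hdet : (Yᴴ * Y).det = 0
  · -- The complementary state is pure, so every vector of the decomposition is a multiple of it.
    obtain ⟨v, hv, hYv⟩ := Matrix.exists_mulVec_eq_zero_iff.2 hdet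
    rw [Matrix.conjTranspose_mul_self_mulVec_eq_zero] at hYv
    have hnv : 0 < ‖v 0‖ ^ 2 + ‖v 1‖ ^ 2 := by
      by_contra hcon
      apply hv
      have h0 : ‖v 0‖ ^ 2 = 0 := by nlinarith [sq_nonneg ‖v 0‖, sq_nonneg ‖v 1‖]
      have h1 : ‖v 1‖ ^ 2 = 0 := by nlinarith [sq_nonneg ‖v 0‖, sq_nonneg ‖v 1‖]
      funext i
      revert i
      simpa [Fin.forall_fin_two] using And.intro h0 h1
    set q := √(‖v 0‖ ^ 2 + ‖v 1‖ ^ 2) with hq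
    have hq2 : q ^ 2 = ‖v 0‖ ^ 2 + ‖v 1‖ ^ 2 := Real.sq_sqrt hnv.le
    have hq0 : 0 < q := Real.sqrt_pos.2 hnv
    have hE := unitary_of_row (x := v 0 / q) (y := v 1 / q) (by
      rw [norm_div, norm_div, Complex.norm_real, Real.norm_of_nonneg hq0.le, div_pow, div_pow,
        ← add_div, ← hq2, div_self (by positivity)])
    set E := !![v 0 / q, v 1 / q; -star (v 1 / q), star (v 0 / q)] with hEdef
    have hrot0 : rotate E (slice Ψ) 0 = 0 := by
      ext j c
      have := congrFun hYv (j, c)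
      simp [Matrix.mulVec, dotProduct, hYdef] at this
      simp [rotate, mix, hEdef, slice]
      linear_combination this / q
    set χ := rotate E (slice Ψ) 1 with hχ
    have hχn : frobSq χ = 1 := by
      have := frobSq_rotate hE (slice Ψ)
      rw [hn, Fin.sum_univ_two, hrot0] at this
      simpa [frobSq] using this
    have htχ : t ≤ ‖χ.det‖ := by
      have h := ht.le_sum (Fin 2) _ (sum_vecMulVec_row hE)
      rw [Fin.sum_univ_two] at h
      change t ≤ ‖(rotate E (slice Ψ) 0).det‖ + ‖χ.det‖ at h
      simpa [hrot0] using h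
    set Z : Matrix (Fin 2 × Fin 2) Unit ℂ := Matrix.of fun x _ => χ x.1 x.2 with hZ
    have hZZ : Z * Zᴴ = reducedBC Ψ := by
      rw [reducedBC_eq_sum hE, Fin.sum_univ_two, hrot0]
      ext x y
      simp [hZ, Matrix.mul_apply, pureState, vecMulVec_apply, hχ]
    have hZdet : (Zᴴ * Z).det = 1 := by
      rw [Matrix.det_unique, ← Complex.ofReal_one, ← hχn]
      simp [hZ, Matrix.mul_apply, frobSq, Fintype.sum_prod_type, Complex.conj_mul']
    obtain ⟨V, hV, hVV⟩ := exists_mixing (hΦΦ.trans hZZ.symm) (by rw [hZdet]; exact one_ne_zero)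
    have hVn : ∑ k, ‖V () k‖ ^ 2 = 1 := by
      have := congrFun₂ hVV () ()
      simp only [Matrix.mul_apply, Matrix.conjTranspose_apply, RCLike.star_def, Complex.mul_conj',
        Matrix.one_apply_eq] at this
      exact_mod_cast this
    have hcol : ∀ k, ‖(Matrix.of fun j c => Φ (j, c) k).det‖ = ‖V () k‖ ^ 2 * ‖χ.det‖ := by
      intro k
      have : (Matrix.of fun j c => Φ (j, c) k) = V () k • χ := by
        ext j c
        simp [hV, Matrix.mul_apply, hZ, mul_comm]
      rw [this, Matrix.det_smul, norm_mul, norm_pow, Fintype.card_fin]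
    simp only [hcol]
    rw [← Finset.sum_mul, hVn, one_mul]
    exact htχ
  · obtain ⟨V, hV, hVV⟩ := exists_mixing (hΦΦ.trans hYY.symm) hdet
    have hres : ∑ k, vecMulVec (star (fun i => V i k)) (fun i => V i k) = 1 := by
      have := congrArg Matrix.transpose hVV
      rw [Matrix.transpose_one] at this
      rw [← this]
      ext i j
      simp [Matrix.sum_apply, vecMulVec_apply, Matrix.mul_apply, mul_comm]
    have := ht.le_sum (Fin N) (fun k i => V i k) hres
    convert this using 4 with k
    ext j c
    rw [hV]
    simp [Matrix.mul_apply, hYdef, mix, slice, mul_comm]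

/-- The convex roof, at the complementary state, of a convex nondecreasing function of the
concurrence of pure states. -/
theorem convexRoof_reducedBC {Ψ : Fin 2 × Fin 2 × Fin 2 → ℂ} {t : ℝ}
    (hn : ∑ i, frobSq (slice Ψ i) = 1) (ht : IsDetGap (slice Ψ) t)
    {f : (Fin 2 × Fin 2 → ℂ) → ℝ} {g : ℝ → ℝ} (hg : ConvexOn ℝ (Set.Icc 0 1) g)
    (hm : MonotoneOn g (Set.Icc 0 1))
    (hf : ∀ φ, ∑ i, ‖φ i‖ ^ 2 = 1 → f φ = g (2 * ‖(asMatrix φ).det‖)) :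
    convexRoof f (reducedBC Ψ) = g (2 * t) := by
  refine IsLeast.csInf_eq ⟨?_, ?_⟩
  -- The decomposition induced on `BC` by the optimal basis of `A`, normalised.
  · obtain ⟨B, hB, hB'⟩ := ht.attained
    set χ := rotate B (slice Ψ) with hχ
    have hsum : ∑ k, frobSq (χ k) = 1 := by rw [frobSq_rotate hB, hn]
    set φ : Fin 2 → Fin 2 × Fin 2 → ℂ := fun k x => ((√(frobSq (χ k)))⁻¹ : ℝ) * χ k x.1 x.2
      with hφ
    have hmat : ∀ k, asMatrix (φ k) = (((√(frobSq (χ k)))⁻¹ : ℝ) : ℂ) • χ k := by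
      intro k; ext j c; simp [asMatrix, hφ]
    have hsq : ∀ k, ‖(((√(frobSq (χ k)))⁻¹ : ℝ) : ℂ)‖ ^ 2 = (frobSq (χ k))⁻¹ := by
      intro k
      rw [Complex.norm_real, Real.norm_of_nonneg (by positivity), inv_pow,
        Real.sq_sqrt (frobSq_nonneg _)]
    have hunit : ∀ k, ∑ i, ‖φ k i‖ ^ 2 = 1 := by
      intro k
      rw [← frobSq_asMatrix, hmat, frobSq_smul, hsq, inv_mul_cancel₀ (hB' k).1.ne']
    have hdet : ∀ k, ‖(asMatrix (φ k)).det‖ = t := by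
      intro k
      rw [hmat, Matrix.det_smul, norm_mul, norm_pow, Fintype.card_fin, hsq, (hB' k).2]
      field_simp [(hB' k).1.ne']
    refine ⟨2, fun k => frobSq (χ k), φ, fun k => frobSq_nonneg _, hsum, hunit, ?_, ?_⟩
    · rw [reducedBC_eq_sum hB]
      refine Finset.sum_congr rfl fun k _ => ?_
      have hinv : (frobSq (χ k) : ℂ) * (((√(frobSq (χ k)))⁻¹ : ℝ) : ℂ) *
          (((√(frobSq (χ k)))⁻¹ : ℝ) : ℂ) = 1 := by
        rw [← Complex.ofReal_mul, ← Complex.ofReal_mul, mul_assoc, ← mul_inv,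
          Real.mul_self_sqrt (frobSq_nonneg _), mul_inv_cancel₀ (hB' k).1.ne', Complex.ofReal_one]
      ext x y
      simp only [pureState, vecMulVec_apply, Pi.star_apply, Matrix.smul_apply, hφ, star_mul',
        RCLike.star_def, Complex.conj_ofReal, Complex.real_smul]
      linear_combination -(χ k x.1 x.2 * (starRingEnd ℂ) (χ k y.1 y.2)) * hinv
    · simp only [hf _ (hunit _), hdet]
      rw [← Finset.sum_mul, hsum, one_mul]
  · rintro x ⟨N, p, φ, hp, hp1, hunit, hdec, rfl⟩
    have hle := le_sum_norm_det_of_decomposition hn ht hp hdec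
    have hx : ∀ k, 2 * ‖(asMatrix (φ k)).det‖ ∈ Set.Icc (0 : ℝ) 1 := fun k =>
      ⟨by positivity, (two_mul_norm_det_le _).trans (by rw [frobSq_asMatrix, hunit])⟩
    simp only [hf _ (hunit _)]
    refine le_sum_of_convexOn hg hm hp hp1 hx (by linarith [ht.nonneg]) ?_
    calc 2 * t ≤ 2 * ∑ k, p k * ‖(asMatrix (φ k)).det‖ := by linarith
      _ = _ := by rw [Finset.mul_sum]; exact Finset.sum_congr rfl fun k _ => by ring

theorem eof_reducedBC {Ψ : Fin 2 × Fin 2 × Fin 2 → ℂ} {t : ℝ}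
    (hn : ∑ i, frobSq (slice Ψ i) = 1) (ht : IsDetGap (slice Ψ) t) :
    eof (reducedBC Ψ) = entropyOfConcurrence (2 * t) := by
  refine convexRoof_reducedBC hn ht strictConvexOn_entropyOfConcurrence.convexOn
    strictMonoOn_entropyOfConcurrence.monotoneOn fun φ hφ => ?_
  rw [traceSnd_pureState, entropy_eq_of_trace_eq_one (posSemidef_self_mul_conjTranspose _),
    det_mul_conjTranspose_re, Real.sqrt_sq (norm_nonneg _)]
  rw [← frobSq_eq_trace, frobSq_asMatrix, hφ, Complex.ofReal_one]

theorem secondSymm_eq_det (X : Matrix (Fin 2) (Fin 2) ℂ) : secondSymm X = X.det.re := by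
  rw [secondSymm]
  congr 1
  simp only [Matrix.trace_fin_two, Matrix.mul_apply, Fin.sum_univ_two, Matrix.det_fin_two]
  ring

theorem concurrence_reducedBC {Ψ : Fin 2 × Fin 2 × Fin 2 → ℂ} {t : ℝ}
    (hn : ∑ i, frobSq (slice Ψ i) = 1) (ht : IsDetGap (slice Ψ) t) :
    concurrence (reducedBC Ψ) = 2 * t := by
  refine convexRoof_reducedBC (g := id) hn ht (convexOn_id (convex_Icc 0 1))
    (fun _ _ _ _ h => h) fun φ hφ => ?_
  rw [traceSnd_pureState, secondSymm_eq_det, det_mul_conjTranspose_re,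
    Real.sqrt_sq (norm_nonneg _), id]

/-! ### The canonical form under local unitaries -/

/-- Diagonalisation of a rank-two state, keeping only the two nonzero eigenvalues. -/
theorem exists_spectral_decomposition {ρ : Matrix (Fin 2 × Fin 2) (Fin 2 × Fin 2) ℂ}
    (hρ : IsDensity ρ) (hrank : ρ.rank = 2) :
    ∃ (l : Fin 2 → ℝ) (ψ : Fin 2 → Fin 2 × Fin 2 → ℂ), (∀ k, 0 < l k) ∧ l 0 + l 1 = 1 ∧
      (∀ k, ∑ x, ‖ψ k x‖ ^ 2 = 1) ∧ ∑ x, star (ψ 0 x) * ψ 1 x = 0 ∧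
      ρ = ∑ k, l k • pureState (ψ k) := by
  have hh := hρ.1.isHermitian
  set W : Matrix (Fin 2 × Fin 2) (Fin 2 × Fin 2) ℂ :=
    (hh.eigenvectorUnitary).1 with hW
  have hWW : Wᴴ * W = 1 := Matrix.mem_unitaryGroup_iff'.1 hh.eigenvectorUnitary.2
  have horth : ∀ i j, ∑ x, star (W x i) * W x j = if i = j then 1 else 0 := by
    intro i j
    have := congrFun₂ hWW i j
    simpa [Matrix.mul_apply, Matrix.one_apply] using this
  have hspec : ρ = ∑ i, hh.eigenvalues i • pureState (fun x => W x i) := by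
    conv_lhs => rw [hh.spectral_theorem, Unitary.conjStarAlgAut_apply]
    ext x y
    rw [Matrix.mul_apply, Matrix.sum_apply]
    refine Finset.sum_congr rfl fun i _ => ?_
    rw [Matrix.mul_diagonal]
    simp only [Matrix.smul_apply, pureState, vecMulVec_apply, Pi.star_apply, Complex.real_smul,
      hW, Matrix.star_apply, Function.comp_apply, Complex.coe_algebraMap]
    ring
  have hcard : Fintype.card {i // hh.eigenvalues i ≠ 0} = 2 := by
    rw [← hh.rank_eq_card_non_zero_eigs, hrank]
  obtain ⟨e⟩ : Nonempty (Fin 2 ≃ {i // hh.eigenvalues i ≠ 0}) :=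
    ⟨(Fintype.equivFinOfCardEq hcard).symm⟩
  have hnorm : ∀ i, ∑ x, ‖W x i‖ ^ 2 = 1 := by
    intro i
    have := horth i i
    simp only [RCLike.star_def, Complex.conj_mul', if_true] at this
    exact_mod_cast this
  have hdec : ρ = ∑ k, hh.eigenvalues (e k) • pureState (fun x => W x (e k)) := by
    rw [e.sum_comp (fun i : {i // hh.eigenvalues i ≠ 0} =>
      hh.eigenvalues i • pureState (fun x => W x i))]
    conv_lhs => rw [hspec]
    rw [← Fintype.sum_subtype_add_sum_subtype (fun i => hh.eigenvalues i ≠ 0)]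
    rw [Finset.sum_eq_zero (s := (Finset.univ : Finset {i // ¬ hh.eigenvalues i ≠ 0})), add_zero]
    intro i _
    have := i.2
    push Not at this
    rw [this, zero_smul]
  refine ⟨fun k => hh.eigenvalues (e k), fun k x => W x (e k), fun k => ?_, ?_,
    fun k => hnorm _, ?_, hdec⟩
  · exact lt_of_le_of_ne (hρ.1.eigenvalues_nonneg _) (e k).2.symm
  · have htr := hρ.2
    rw [hdec, Matrix.trace_sum] at htr
    have hp : ∀ i, (pureState (fun x => W x i)).trace = 1 := by
      intro i
      rw [← Complex.ofReal_one, ← hnorm i]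
      simp [pureState, Matrix.trace, vecMulVec_apply, Complex.mul_conj']
    simp only [Matrix.trace_smul, hp, Fin.sum_univ_two, Complex.real_smul, mul_one] at htr
    exact_mod_cast htr
  · rw [horth, if_neg]
    intro h
    have := e.injective (Subtype.ext h)
    exact absurd this (by decide)

theorem asMatrix_kronecker_mulVec (U V : Matrix (Fin 2) (Fin 2) ℂ) (ψ : Fin 2 × Fin 2 → ℂ) :
    asMatrix ((U ⊗ₖ V) *ᵥ ψ) = U * asMatrix ψ * Vᵀ := by
  ext i j
  simp [asMatrix, Matrix.mulVec, dotProduct, Matrix.mul_apply, Fintype.sum_prod_type,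
    Fin.sum_univ_two]
  ring

theorem mul_pureState_mul_conjTranspose {n : Type*} [Fintype n] (S : Matrix n n ℂ) (ψ : n → ℂ) :
    S * pureState ψ * Sᴴ = pureState (S *ᵥ ψ) := by
  rw [pureState, pureState, Matrix.mul_vecMulVec, Matrix.vecMulVec_mul, Matrix.star_mulVec]

theorem asMatrix_injective : Function.Injective asMatrix := fun _ _ h =>
  funext fun x => congrFun₂ h x.1 x.2

theorem asMatrix_canonVec₀ (a b : Fin 2 → ℂ) (c d : ℂ) :
    asMatrix (canonVec₀ a b c d) = !![a 0, b 0 * c; 0, b 0 * d] := by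
  ext i j
  fin_cases i <;> fin_cases j <;> simp [asMatrix, canonVec₀, prodVec]

theorem asMatrix_canonVec₁ (a b : Fin 2 → ℂ) (c d : ℂ) :
    asMatrix (canonVec₁ a b c d) = !![0, b 1 * -star d; a 1, b 1 * star c] := by
  ext i j
  fin_cases i <;> fin_cases j <;> simp [asMatrix, canonVec₁, prodVec]

/-- Two orthogonal vectors of the plane are multiples of the members of an orthonormal basis,
whether or not they vanish. -/
theorem exists_basis_of_orthogonal {p₀ p₁ r₀ r₁ : ℂ} (h : star p₀ * r₀ + star p₁ * r₁ = 0) :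
    ∃ c d x y : ℂ, ‖c‖ ^ 2 + ‖d‖ ^ 2 = 1 ∧ p₀ = x * c ∧ p₁ = x * d ∧
      r₀ = y * -star d ∧ r₁ = y * star c := by
  have normalize : ∀ u v : ℂ, ¬ (u = 0 ∧ v = 0) → ∃ q : ℝ, q ≠ 0 ∧
      ‖u / q‖ ^ 2 + ‖v / q‖ ^ 2 = 1 := by
    intro u v huv
    have hpos : 0 < ‖u‖ ^ 2 + ‖v‖ ^ 2 := by
      by_contra hcon
      apply huv
      have h0 : ‖u‖ ^ 2 = 0 := by nlinarith [sq_nonneg ‖u‖, sq_nonneg ‖v‖]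
      have h1 : ‖v‖ ^ 2 = 0 := by nlinarith [sq_nonneg ‖u‖, sq_nonneg ‖v‖]
      simpa using And.intro h0 h1
    have hq0 := Real.sqrt_pos.2 hpos
    refine ⟨√(‖u‖ ^ 2 + ‖v‖ ^ 2), hq0.ne', ?_⟩
    rw [norm_div, norm_div, Complex.norm_real, Real.norm_of_nonneg hq0.le, div_pow, div_pow,
      ← add_div, Real.sq_sqrt hpos.le, div_self hpos.ne']
  obtain ⟨c, d, x, hcd, h0, h1, hr⟩ : ∃ c d x : ℂ, ‖c‖ ^ 2 + ‖d‖ ^ 2 = 1 ∧ p₀ = x * c ∧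
      p₁ = x * d ∧ star c * r₀ + star d * r₁ = 0 := by
    by_cases hp : p₀ = 0 ∧ p₁ = 0
    · by_cases hr : r₀ = 0 ∧ r₁ = 0
      · exact ⟨1, 0, 0, by simp, by simp [hp.1], by simp [hp.2], by simp [hr.1]⟩
      · obtain ⟨q, -, hq1⟩ := normalize _ _ hr
        refine ⟨star (r₁ / q), -star (r₀ / q), 0, ?_, by simp [hp.1], by simp [hp.2], ?_⟩
        · rw [norm_neg, norm_star, norm_star]; linarith
        · simp only [star_neg, star_star]; ring
    · obtain ⟨q, hq0, hq1⟩ := normalize _ _ hp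
      have hq0' : (q : ℂ) ≠ 0 := by exact_mod_cast hq0
      refine ⟨p₀ / q, p₁ / q, q, hq1, by field_simp, by field_simp, ?_⟩
      simp only [star_div₀, RCLike.star_def, Complex.conj_ofReal] at h ⊢
      field_simp
      linear_combination h
  have hcd' : c * star c + d * star d = 1 := by
    rw [RCLike.star_def, Complex.mul_conj', Complex.mul_conj']
    exact_mod_cast hcd
  refine ⟨c, d, x, -d * r₀ + c * r₁, hcd, h0, h1, ?_, ?_⟩
  · linear_combination -r₀ * hcd' + c * hr
  · linear_combination -r₁ * hcd' + d * hr

theorem exists_hasCanonicalForm {ρ : Matrix (Fin 2 × Fin 2) (Fin 2 × Fin 2) ℂ}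
    (hρ : IsDensity ρ) (hrank : ρ.rank = 2) :
    ∃ (l : Fin 2 → ℝ) (a b : Fin 2 → ℂ) (c d : ℂ), HasCanonicalForm ρ l a b c d := by
  obtain ⟨l, ψ, hl, hl1, hψ, horth, hdec⟩ := exists_spectral_decomposition hρ hrank
  set A₀ := asMatrix (ψ 0) with hA₀
  set A₁ := asMatrix (ψ 1) with hA₁
  have htr : (star (A₀ 0 0) * A₁ 0 0 + star (A₀ 1 0) * A₁ 1 0) +
      (star (A₀ 0 1) * A₁ 0 1 + star (A₀ 1 1) * A₁ 1 1) = 0 := by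
    simp only [Fintype.sum_prod_type, Fin.sum_univ_two] at horth
    simp only [hA₀, hA₁, asMatrix, Matrix.of_apply]
    linear_combination horth
  -- A basis of `B` in which the two vectors have orthogonal components at each basis element.
  obtain ⟨x, y, hxy, hN⟩ := exists_unit_sesq_eq_zero
    (star (A₀ 0 0) * A₁ 0 0 + star (A₀ 1 0) * A₁ 1 0)
    (star (A₀ 0 0) * A₁ 0 1 + star (A₀ 1 0) * A₁ 1 1)
    (star (A₀ 0 1) * A₁ 0 0 + star (A₀ 1 1) * A₁ 1 0)
  have hV := unitary_of_row hxy
  set V := !![x, y; -star y, star x] with hVdef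
  set C₀ := A₀ * Vᵀ with hC₀
  set C₁ := A₁ * Vᵀ with hC₁
  have horth0 : star (C₀ 0 0) * C₁ 0 0 + star (C₀ 1 0) * C₁ 1 0 = 0 := by
    simp only [hC₀, hC₁, hVdef, Matrix.mul_apply, Fin.sum_univ_two, Matrix.transpose_apply,
      Matrix.of_apply, Matrix.cons_val_zero, Matrix.cons_val_one, star_add, star_mul']
    linear_combination hN + y * star y * htr
  have horth1 : star (C₀ 0 1) * C₁ 0 1 + star (C₀ 1 1) * C₁ 1 1 = 0 := by
    simp only [hC₀, hC₁, hVdef, Matrix.mul_apply, Fin.sum_univ_two, Matrix.transpose_apply,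
      Matrix.of_apply, Matrix.cons_val_zero, Matrix.cons_val_one, star_add, star_mul', star_neg,
      star_star]
    linear_combination -hN + x * star x * htr
  -- A basis of `A` that takes the components at the first basis element of `B` to multiples of the
  -- standard basis vectors.
  obtain ⟨c', d', a₀, a₁, hcd', h00, h01, h10, h11⟩ := exists_basis_of_orthogonal horth0
  have hU := unitary_of_row (x := star c') (y := star d')
    (by rw [norm_star, norm_star]; exact hcd')
  set U := !![star c', star d'; -star (star d'), star (star c')] with hUdef
  have hcd2 : c' * star c' + d' * star d' = 1 := by
    rw [RCLike.star_def, Complex.mul_conj', Complex.mul_conj']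
    exact_mod_cast hcd'
  set D₀ := U * A₀ * Vᵀ with hD₀
  set D₁ := U * A₁ * Vᵀ with hD₁
  have hD₀' : D₀ = U * C₀ := Matrix.mul_assoc _ _ _
  have hD₁' : D₁ = U * C₁ := Matrix.mul_assoc _ _ _
  have horthD : star (D₀ 0 1) * D₁ 0 1 + star (D₀ 1 1) * D₁ 1 1 = 0 := by
    rw [hD₀', hD₁']
    simp only [hUdef, Matrix.mul_apply, Fin.sum_univ_two, Matrix.of_apply, Matrix.cons_val_zero,
      Matrix.cons_val_one, star_add, star_mul', star_neg, star_star]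
    linear_combination horth1 + (star (C₀ 0 1) * C₁ 0 1 + star (C₀ 1 1) * C₁ 1 1) * hcd2
  obtain ⟨c, d, b₀, b₁, hcd, g00, g01, g10, g11⟩ := exists_basis_of_orthogonal horthD
  have e00 : D₀ 0 0 = a₀ := by
    rw [hD₀', Matrix.mul_apply, Fin.sum_univ_two, h00, h01, hUdef]
    simp only [Matrix.of_apply, Matrix.cons_val_zero, Matrix.cons_val_one]
    linear_combination a₀ * hcd2
  have e10 : D₀ 1 0 = 0 := by
    rw [hD₀', Matrix.mul_apply, Fin.sum_univ_two, h00, h01, hUdef]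
    simp only [Matrix.of_apply, Matrix.cons_val_zero, Matrix.cons_val_one, star_star]
    ring
  have f00 : D₁ 0 0 = 0 := by
    rw [hD₁', Matrix.mul_apply, Fin.sum_univ_two, h10, h11, hUdef]
    simp only [Matrix.of_apply, Matrix.cons_val_zero, Matrix.cons_val_one]
    ring
  have f10 : D₁ 1 0 = a₁ := by
    rw [hD₁', Matrix.mul_apply, Fin.sum_univ_two, h10, h11, hUdef]
    simp only [Matrix.of_apply, Matrix.cons_val_zero, Matrix.cons_val_one, star_star]
    linear_combination a₁ * hcd2
  have hD0 : D₀ = asMatrix (canonVec₀ ![a₀, a₁] ![b₀, b₁] c d) := by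
    rw [asMatrix_canonVec₀]
    ext i j
    fin_cases i <;> fin_cases j
    exacts [e00, g00, e10, g01]
  have hD1 : D₁ = asMatrix (canonVec₁ ![a₀, a₁] ![b₀, b₁] c d) := by
    rw [asMatrix_canonVec₁]
    ext i j
    fin_cases i <;> fin_cases j
    exacts [f00, g10, f10, g11]
  have hn0 : ‖a₀‖ ^ 2 + ‖b₀‖ ^ 2 = 1 := by
    have h : frobSq D₀ = 1 := by
      rw [hD₀, frobSq_mul_mul_transpose hU hV, hA₀, frobSq_asMatrix, hψ]
    rw [hD0, asMatrix_canonVec₀] at h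
    simp [frobSq, Fin.sum_univ_two, mul_pow] at h
    linear_combination h - ‖b₀‖ ^ 2 * hcd
  have hn1 : ‖a₁‖ ^ 2 + ‖b₁‖ ^ 2 = 1 := by
    have h : frobSq D₁ = 1 := by
      rw [hD₁, frobSq_mul_mul_transpose hU hV, hA₁, frobSq_asMatrix, hψ]
    rw [hD1, asMatrix_canonVec₁] at h
    simp [frobSq, Fin.sum_univ_two, mul_pow] at h
    linear_combination h - ‖b₁‖ ^ 2 * hcd
  refine ⟨l, ![a₀, a₁], ![b₀, b₁], c, d, hl, hl1, ?_, hcd, U, hU, V, hV, ?_⟩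
  · rw [Fin.forall_fin_two]
    exact ⟨hn0, hn1⟩
  · have hv0 : (U ⊗ₖ V) *ᵥ ψ 0 = canonVec₀ ![a₀, a₁] ![b₀, b₁] c d :=
      asMatrix_injective (by rw [asMatrix_kronecker_mulVec, ← hD0])
    have hv1 : (U ⊗ₖ V) *ᵥ ψ 1 = canonVec₁ ![a₀, a₁] ![b₀, b₁] c d :=
      asMatrix_injective (by rw [asMatrix_kronecker_mulVec, ← hD1])
    conv_lhs => rw [hdec]
    rw [Fin.sum_univ_two, Matrix.mul_add, Matrix.add_mul, Matrix.mul_smul, Matrix.mul_smul,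
      Matrix.smul_mul, Matrix.smul_mul, mul_pureState_mul_conjTranspose,
      mul_pureState_mul_conjTranspose, hv0, hv1]

theorem exists_reducedAB_eq {ρ : Matrix (Fin 2 × Fin 2) (Fin 2 × Fin 2) ℂ}
    (hρ : IsDensity ρ) (hrank : ρ.rank = 2) :
    ∃ Ψ : Fin 2 × Fin 2 × Fin 2 → ℂ, reducedAB Ψ = ρ := by
  obtain ⟨l, ψ, hl, -, -, -, hdec⟩ := exists_spectral_decomposition hρ hrank
  refine ⟨fun x => √(l x.2.2) * ψ x.2.2 (x.1, x.2.1), ?_⟩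
  conv_rhs => rw [hdec]
  ext x y
  simp only [reducedAB, traceSnd, pureState, vecMulVec_apply, Matrix.of_apply, Pi.star_apply,
    star_mul', RCLike.star_def, Complex.conj_ofReal, Matrix.sum_apply, Matrix.smul_apply,
    Complex.real_smul]
  refine Finset.sum_congr rfl fun k _ => ?_
  have : (√(l k) : ℂ) * √(l k) = l k := by
    rw [← Complex.ofReal_mul, Real.mul_self_sqrt (hl k).le]
  rw [← this]
  ring

/-- Any purification of a state in canonical form is, up to unitaries of the three parties, the one
built from the canonical vectors. The gap of the determinant form does not see the unitaries. -/
theorem singularGapSq_of_hasCanonicalForm {Ψ : Fin 2 × Fin 2 × Fin 2 → ℂ} {l : Fin 2 → ℝ}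
    {a b : Fin 2 → ℂ} {c d : ℂ} (h : HasCanonicalForm (reducedAB Ψ) l a b c d) :
    singularGapSq (detForm (slice Ψ)) = l 0 * l 1 * singularGapSq
      !![-(a 0 * b 1 * star d), (a 0 * b 1 * star c - a 1 * b 0 * c) / 2;
        (a 0 * b 1 * star c - a 1 * b 0 * c) / 2, -(a 1 * b 0 * d)] := by
  obtain ⟨hl, -, hab, hcd, U, hU, V, hV, heq⟩ := h
  set Φ : Matrix (Fin 2 × Fin 2) (Fin 2) ℂ := Matrix.of fun x k => Ψ (x.1, x.2, k) with hΦ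
  have hΦΦ : Φ * Φᴴ = reducedAB Ψ := by
    ext x y
    simp [hΦ, Matrix.mul_apply, reducedAB, traceSnd, pureState, vecMulVec_apply]
  set ψ : Fin 2 → Fin 2 × Fin 2 → ℂ := ![canonVec₀ a b c d, canonVec₁ a b c d] with hψ
  set Y : Matrix (Fin 2 × Fin 2) (Fin 2) ℂ := Matrix.of fun x k => (√(l k) : ℂ) * ψ k x with hY
  -- The columns of `Y` are orthogonal and nonzero, so every purification is a unitary mixing of them.
  have hsq : ∀ k, (√(l k) : ℂ) * √(l k) = l k := by
    intro k
    rw [← Complex.ofReal_mul, Real.mul_self_sqrt (hl k).le]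
  have hYY : (U ⊗ₖ V * Φ) * (U ⊗ₖ V * Φ)ᴴ = Y * Yᴴ := by
    calc (U ⊗ₖ V * Φ) * (U ⊗ₖ V * Φ)ᴴ = (U ⊗ₖ V) * (Φ * Φᴴ) * (U ⊗ₖ V)ᴴ := by
          rw [Matrix.conjTranspose_mul]; simp only [Matrix.mul_assoc]
      _ = _ := by
          rw [hΦΦ, heq]
          ext x y
          simp only [hY, hψ, pureState, vecMulVec_apply, Matrix.add_apply, Matrix.smul_apply,
            Matrix.mul_apply, Fin.sum_univ_two, Matrix.conjTranspose_apply, Matrix.of_apply,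
            Complex.real_smul, Pi.star_apply, star_mul', RCLike.star_def, Complex.conj_ofReal,
            Matrix.cons_val_zero, Matrix.cons_val_one, ← hsq]
          ring
  have hcc : ∀ z : ℂ, (starRingEnd ℂ) z * z = (‖z‖ : ℂ) ^ 2 := Complex.conj_mul'
  have hdet : (Yᴴ * Y).det ≠ 0 := by
    have hab' : ∀ k, (starRingEnd ℂ) (a k) * a k + (starRingEnd ℂ) (b k) * b k = 1 := by
      intro k
      rw [hcc, hcc]
      exact_mod_cast hab k
    have hcd' : (starRingEnd ℂ) c * c + (starRingEnd ℂ) d * d = 1 := by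
      rw [hcc, hcc]
      exact_mod_cast hcd
    have : Yᴴ * Y = !![(l 0 : ℂ), 0; 0, (l 1 : ℂ)] := by
      ext i j
      fin_cases i <;> fin_cases j <;>
        simp [hY, hψ, Matrix.mul_apply, Fintype.sum_prod_type, Fin.sum_univ_two, canonVec₀,
          canonVec₁, prodVec]
      · rw [← hsq]
        linear_combination (√(l 0) : ℂ) * √(l 0) * hab' 0 +
          (√(l 0) : ℂ) * √(l 0) * ((starRingEnd ℂ) (b 0) * b 0) * hcd'
      · ring
      · ring
      · rw [← hsq]
        linear_combination (√(l 1) : ℂ) * √(l 1) * hab' 1 +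
          (√(l 1) : ℂ) * √(l 1) * ((starRingEnd ℂ) (b 1) * b 1) * hcd'
    rw [this, Matrix.det_fin_two]
    have h0 := (hl 0).ne'
    have h1 := (hl 1).ne'
    simp [h0, h1]
  obtain ⟨Z, hZ, hZZ⟩ := exists_mixing hYY hdet
  have hZu : Z ∈ Matrix.unitaryGroup (Fin 2) ℂ := Matrix.mem_unitaryGroup_iff.2 hZZ
  set y : Fin 2 → Matrix (Fin 2) (Fin 2) ℂ := fun i => Matrix.of fun j k => Y (i, j) k with hy
  have hslice : rotate U (fun i => V * slice Ψ i * 1) = fun i => 1 * y i * Z := by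
    funext i
    ext j k
    have := congrFun₂ hZ (i, j) k
    simp only [Matrix.mul_apply, Fintype.sum_prod_type, Fin.sum_univ_two,
      Matrix.kroneckerMap_apply] at this
    simp only [rotate, mix, Matrix.mul_one, Matrix.one_mul, Matrix.add_apply, Matrix.smul_apply,
      smul_eq_mul, Matrix.mul_apply, Fin.sum_univ_two, slice, Matrix.of_apply, hy]
    rw [← this]
    simp only [hΦ, Matrix.of_apply]
    ring
  have hforms := congrArg (fun w => singularGapSq (detForm w)) hslice
  simp only [detForm_rotate, singularGapSq_congr hU, detForm_mul_mul, singularGapSq_smul,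
    norm_mul, norm_det_of_unitary hV, norm_det_of_unitary hZu, Matrix.det_one, norm_one] at hforms
  have hyform : detForm y = ((√(l 0) : ℂ) * √(l 1)) •
      !![-(a 0 * b 1 * star d), (a 0 * b 1 * star c - a 1 * b 0 * c) / 2;
        (a 0 * b 1 * star c - a 1 * b 0 * c) / 2, -(a 1 * b 0 * d)] := by
    ext i j
    fin_cases i <;> fin_cases j <;>
      simp [detForm, hy, hY, hψ, canonVec₀, canonVec₁, prodVec] <;> ring
  rw [hyform, singularGapSq_smul, norm_mul, Complex.norm_real, Complex.norm_real,
    Real.norm_of_nonneg (Real.sqrt_nonneg _), Real.norm_of_nonneg (Real.sqrt_nonneg _)] at hforms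
  simp only [mul_pow, Real.sq_sqrt (hl 0).le, Real.sq_sqrt (hl 1).le] at hforms
  linarith

/-- The bracket of the concurrence formula, computed from the determinant form of the canonical
vectors. -/
theorem four_mul_singularGapSq (a b : Fin 2 → ℂ) (c d : ℂ) :
    4 * singularGapSq
      !![-(a 0 * b 1 * star d), (a 0 * b 1 * star c - a 1 * b 0 * c) / 2;
        (a 0 * b 1 * star c - a 1 * b 0 * c) / 2, -(a 1 * b 0 * d)] =
      2 * (‖a 0 * b 1 * star c - a 1 * b 0 * c‖ ^ 2
        + 2 * ‖d‖ ^ 2 * (‖a 0‖ ^ 2 * ‖b 1‖ ^ 2 + ‖a 1‖ ^ 2 * ‖b 0‖ ^ 2))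
      - 2 * ‖(a 0 * b 1 * star c - a 1 * b 0 * c) ^ 2
        - 4 * a 0 * a 1 * b 0 * b 1 * (‖d‖ : ℂ) ^ 2‖ := by
  set X := a 0 * b 1 * star c - a 1 * b 0 * c
  have hdet : (!![-(a 0 * b 1 * star d), X / 2; X / 2, -(a 1 * b 0 * d)]).det =
      -((X ^ 2 - 4 * a 0 * a 1 * b 0 * b 1 * (‖d‖ : ℂ) ^ 2) / 4) := by
    rw [Matrix.det_fin_two, ← Complex.mul_conj']
    simp
    ring
  rw [singularGapSq, hdet, norm_neg, norm_div]
  simp only [frobSq, Fin.sum_univ_two, Matrix.of_apply, Matrix.cons_val_zero, Matrix.cons_val_one,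
    norm_neg, norm_mul, norm_div, norm_star, mul_pow, div_pow]
  norm_num
  ring

theorem concurrence_sq_of_hasCanonicalForm {Ψ : Fin 2 × Fin 2 × Fin 2 → ℂ}
    (htr : (reducedAB Ψ).trace = 1) {l : Fin 2 → ℝ} {a b : Fin 2 → ℂ} {c d : ℂ}
    (h : HasCanonicalForm (reducedAB Ψ) l a b c d) :
    concurrence (reducedBC Ψ) ^ 2 =
      2 * l 0 * l 1 * (‖a 0 * b 1 * star c - a 1 * b 0 * c‖ ^ 2
        + 2 * ‖d‖ ^ 2 * (‖a 0‖ ^ 2 * ‖b 1‖ ^ 2 + ‖a 1‖ ^ 2 * ‖b 0‖ ^ 2))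
      - 2 * l 0 * l 1 * ‖(a 0 * b 1 * star c - a 1 * b 0 * c) ^ 2
        - 4 * a 0 * a 1 * b 0 * b 1 * (‖d‖ : ℂ) ^ 2‖ := by
  have hn := sum_frobSq_slice htr
  obtain ⟨t, ht⟩ := exists_isDetGap hn
  rw [concurrence_reducedBC hn ht, mul_pow, ht.sq_eq, singularGapSq_of_hasCanonicalForm h]
  linear_combination l 0 * l 1 * four_mul_singularGapSq a b c d

theorem concurrence_sq_of_real {Ψ : Fin 2 × Fin 2 × Fin 2 → ℂ}
    (htr : (reducedAB Ψ).trace = 1) {l a b : Fin 2 → ℝ} {c d : ℝ}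
    (h : HasCanonicalForm (reducedAB Ψ) l (fun k => (a k : ℂ)) (fun k => (b k : ℂ)) c d) :
    concurrence (reducedBC Ψ) ^ 2 =
      2 * l 0 * l 1 * (c ^ 2 * (a 0 * b 1 - a 1 * b 0) ^ 2
        + 2 * d ^ 2 * (a 0 ^ 2 * b 1 ^ 2 + a 1 ^ 2 * b 0 ^ 2))
      - 2 * l 0 * l 1 * |c ^ 2 * (a 0 * b 1 - a 1 * b 0) ^ 2
        - 4 * a 0 * a 1 * b 0 * b 1 * d ^ 2| := by
  rw [concurrence_sq_of_hasCanonicalForm htr h]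
  have hX : (a 0 : ℂ) * b 1 * star (c : ℂ) - a 1 * b 0 * c =
      ((c * (a 0 * b 1 - a 1 * b 0) : ℝ) : ℂ) := by
    rw [RCLike.star_def, Complex.conj_ofReal]
    push_cast
    ring
  have hd : ((‖(d : ℂ)‖ : ℝ) : ℂ) ^ 2 = ((d ^ 2 : ℝ) : ℂ) := by
    rw [Complex.norm_real, ← Complex.ofReal_pow, Real.norm_eq_abs, sq_abs]
  have hY : ((c * (a 0 * b 1 - a 1 * b 0) : ℝ) : ℂ) ^ 2 -
      4 * a 0 * a 1 * b 0 * b 1 * ((d ^ 2 : ℝ) : ℂ) =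
      ((c ^ 2 * (a 0 * b 1 - a 1 * b 0) ^ 2 - 4 * a 0 * a 1 * b 0 * b 1 * d ^ 2 : ℝ) : ℂ) := by
    push_cast
    ring
  rw [hX, hd, hY]
  simp only [Complex.norm_real, Real.norm_eq_abs, sq_abs, mul_pow]

/-! ### The minimal average entropy and the classical correlation -/

theorem isGreatest_infoGains {ρ : Matrix (Fin 2 × Fin 2) (Fin 2 × Fin 2) ℂ} {x : ℝ}
    (h : IsLeast (avgEntropies ρ) x) : IsGreatest (infoGains ρ) (entropy (traceFst ρ) - x) := by
  obtain ⟨⟨n, M, hM, rfl⟩, hlow⟩ := h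
  refine ⟨⟨n, M, hM, rfl⟩, ?_⟩
  rintro _ ⟨m, N, hN, rfl⟩
  exact sub_le_sub_left (hlow ⟨m, N, hN, rfl⟩) _

end RankTwoDiscord

theorem mainTheorem3 (ρ : Matrix (Fin 2 × Fin 2) (Fin 2 × Fin 2) ℂ)
    (hρ : IsDensity ρ) (hrank : ρ.rank = 2) :
    -- some von Neumann measurement is optimal among all POVMs, with an equi-entropy decomposition
    (∃ P : Fin 2 → Matrix (Fin 2) (Fin 2) ℂ, IsVonNeumann P ∧
      IsLeast (avgEntropies ρ) (avgEntropy ρ P) ∧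
      IsGreatest (infoGains ρ) (entropy (traceFst ρ) - avgEntropy ρ P) ∧
      classicalCorr ρ = entropy (traceFst ρ) - avgEntropy ρ P ∧
      discord ρ = entropy (traceSnd ρ) + avgEntropy ρ P - entropy ρ ∧
      (∀ k, 0 < outcomeProb ρ (P k)) ∧
      entropy (postState ρ (P 0)) = entropy (postState ρ (P 1))) ∧
    -- every optimal POVM induces an equi-entropy decomposition
    (∀ (n : ℕ) (M : Fin n → Matrix (Fin 2) (Fin 2) ℂ), IsPOVM M →
      IsLeast (avgEntropies ρ) (avgEntropy ρ M) →
      ∀ j k, 0 < outcomeProb ρ (M j) → 0 < outcomeProb ρ (M k) →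
        entropy (postState ρ (M j)) = entropy (postState ρ (M k))) ∧
    -- values in terms of the complement state
    (∃ Ψ : Fin 2 × Fin 2 × Fin 2 → ℂ, reducedAB Ψ = ρ) ∧
    (∀ Ψ : Fin 2 × Fin 2 × Fin 2 → ℂ, reducedAB Ψ = ρ →
      minAvgEntropy ρ = eof (reducedBC Ψ) ∧
      classicalCorr ρ = entropy (traceFst ρ) - eof (reducedBC Ψ) ∧
      discord ρ = entropy (traceSnd ρ) + eof (reducedBC Ψ) - entropy ρ ∧
      eof (reducedBC Ψ) = binH ((1 + √(1 - concurrence (reducedBC Ψ) ^ 2)) / 2)) ∧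
    -- the concurrence in the parameters of the canonical form
    (∃ (l : Fin 2 → ℝ) (a b : Fin 2 → ℂ) (c d : ℂ), HasCanonicalForm ρ l a b c d) ∧
    (∀ Ψ : Fin 2 × Fin 2 × Fin 2 → ℂ, reducedAB Ψ = ρ →
      ∀ (l : Fin 2 → ℝ) (a b : Fin 2 → ℂ) (c d : ℂ), HasCanonicalForm ρ l a b c d →
        concurrence (reducedBC Ψ) ^ 2 =
          2 * l 0 * l 1 * (‖a 0 * b 1 * star c - a 1 * b 0 * c‖ ^ 2
            + 2 * ‖d‖ ^ 2 * (‖a 0‖ ^ 2 * ‖b 1‖ ^ 2 + ‖a 1‖ ^ 2 * ‖b 0‖ ^ 2))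
          - 2 * l 0 * l 1 * ‖(a 0 * b 1 * star c - a 1 * b 0 * c) ^ 2
            - 4 * a 0 * a 1 * b 0 * b 1 * (‖d‖ : ℂ) ^ 2‖) ∧
    -- the same for real parameters
    (∀ Ψ : Fin 2 × Fin 2 × Fin 2 → ℂ, reducedAB Ψ = ρ →
      ∀ (l a b : Fin 2 → ℝ) (c d : ℝ),
        HasCanonicalForm ρ l (fun k => (a k : ℂ)) (fun k => (b k : ℂ)) (c : ℂ) (d : ℂ) →
        (4 * a 0 * a 1 * b 0 * b 1 * d ^ 2 ≤ c ^ 2 * (a 0 * b 1 - a 1 * b 0) ^ 2 →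
          concurrence (reducedBC Ψ) ^ 2 = 4 * l 0 * l 1 * d ^ 2 * (a 0 * b 1 + a 1 * b 0) ^ 2) ∧
        (c ^ 2 * (a 0 * b 1 - a 1 * b 0) ^ 2 < 4 * a 0 * a 1 * b 0 * b 1 * d ^ 2 →
          concurrence (reducedBC Ψ) ^ 2 = 4 * l 0 * l 1 * (a 0 * b 1 - a 1 * b 0) ^ 2)) := by
  obtain ⟨Ψ₀, hΨ₀⟩ := exists_reducedAB_eq hρ hrank
  refine ⟨?_, ?_, ⟨Ψ₀, hΨ₀⟩, ?_, exists_hasCanonicalForm hρ hrank, ?_, ?_⟩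
  · subst hΨ₀
    obtain ⟨t, ht⟩ := exists_isDetGap (sum_frobSq_slice hρ.2)
    obtain ⟨P, hvN, hP, havg, hpos, hent⟩ := exists_optimal_isVonNeumann hρ.2 ht
    have hleast : IsLeast (avgEntropies (reducedAB Ψ₀)) (avgEntropy (reducedAB Ψ₀) P) :=
      ⟨⟨2, P, hP, rfl⟩, by
        rintro _ ⟨n, M, hM, rfl⟩
        rw [havg]
        exact entropyOfConcurrence_le_avgEntropy hρ.2 ht hM⟩
    have hgreatest := isGreatest_infoGains hleast
    refine ⟨P, hvN, hleast, hgreatest, hgreatest.csSup_eq, ?_, hpos, by rw [hent, hent]⟩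
    rw [discord, classicalCorr, hgreatest.csSup_eq, mutualInfo]
    ring
  · subst hΨ₀
    intro n M hM hopt j k hj hk
    obtain ⟨t, ht⟩ := exists_isDetGap (sum_frobSq_slice hρ.2)
    obtain ⟨P, -, hP, havg, -, -⟩ := exists_optimal_isVonNeumann hρ.2 ht
    exact entropy_postState_eq_of_optimal hρ.2 ht hM
      ((hopt.2 ⟨2, P, hP, rfl⟩).trans_eq havg) hj hk
  · rintro Ψ rfl
    have hn := sum_frobSq_slice hρ.2
    obtain ⟨t, ht⟩ := exists_isDetGap hn
    obtain ⟨P, -, hP, havg, -, -⟩ := exists_optimal_isVonNeumann hρ.2 ht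
    have hleast : IsLeast (avgEntropies (reducedAB Ψ)) (eof (reducedBC Ψ)) := by
      rw [eof_reducedBC hn ht]
      refine ⟨⟨2, P, hP, havg.symm⟩, ?_⟩
      rintro _ ⟨n, M, hM, rfl⟩
      exact entropyOfConcurrence_le_avgEntropy hρ.2 ht hM
    have hgreatest := isGreatest_infoGains hleast
    refine ⟨hleast.csInf_eq, hgreatest.csSup_eq, ?_, ?_⟩
    · rw [discord, classicalCorr, hgreatest.csSup_eq, mutualInfo]
      ring
    · rw [eof_reducedBC hn ht, concurrence_reducedBC hn ht, entropyOfConcurrence]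
  · rintro Ψ rfl l a b c d hform
    exact concurrence_sq_of_hasCanonicalForm hρ.2 hform
  · rintro Ψ rfl l a b c d hform
    rw [concurrence_sq_of_real hρ.2 hform]
    constructor
    · intro h
      rw [abs_of_nonneg (sub_nonneg.2 h)]
      ring
    · intro h
      rw [abs_of_neg (sub_neg.2 h)]
      have hcd : c ^ 2 + d ^ 2 = 1 := by simpa using hform.2.2.2.1
      linear_combination 4 * l 0 * l 1 * (a 0 * b 1 - a 1 * b 0) ^ 2 * hcd
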